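/- **Setting.** For each $n$ let $p=p_n$, $T=T_n$, $s=s_n$ be positive integers with $n\le p$ and $s\le p$, such that $\frac sn\bigl(T+\log\frac ps\bigr)\to 0$ as $n\to\infty$. Fix constants $\sigma>0$, $0<C_{\min}\le C_{\max}$ and $\eta_1,\eta_2>0$ not depending on $n$. Let $\Sigma=\Sigma_n\in\mathbb R^{p\times p}$ be symmetric with spectrum contained in $[C_{\min},C_{\max}]$ and $\max_j\Sigma_{jj}\le 1$, and let $B^*\in\mathbb R^{p\times T}$ be deterministic with at most $s$ nonzero rows. Let $X\in\mathbb R^{n\times p}$ have i.i.d. $N_p(0,\Sigma)$ rows, let $E\in\mathbb R^{n\times T}$ have i.i.d. $N(0,\sigma^2)$ entries, with $X$ and $E$ independent, and let $Y=XB^*+E$. Let $$\hat B\in\operatorname*{arg\,min}_{B\in\mathbb R^{p\times T}}\Bigl(\frac1{2nT}\|Y-XB\|_F^2+\lambda\sum_{j=1}^p\|B^\top e_j\|_2\Bigr),$$ $$\lambda=(1+\eta_2)\lambda_0,\qquad \lambda_0=\frac{(1+\eta_1)\,\sigma\max_j\Sigma_{jj}^{1/2}}{\sqrt{nT}}\Bigl(1+\sqrt{\tfrac2T\log\tfrac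 ps}\Bigr).$$ Let $\hat S=\{j:\hat B^\top e_j\ne0\}$, and let $X_{\hat S}\in\mathbb R^{n\times p}$ be $X$ with the columns outside $\hat S$ replaced by $0$. For $j\in\hat S$ let $H^{(j)}=\lambda\|\hat B^\top e_j\|_2^{-1}\bigl(I_T-\|\hat B^\top e_j\|_2^{-2}\,\hat B^\top e_je_j^\top\hat B\bigr)$. Put $\tilde X=I_T\otimes X_{\hat S}$ and $\tilde H=\sum_{j\in\hat S}H^{(j)}\otimes(e_je_j^\top)$. The interaction matrix $\hat A\in\mathbb R^{T\times T}$ is given by $$\hat A_{tt'}=\operatorname{tr}\bigl[(e_t^\top\otimes X_{\hat S})\,(\tilde X^\top\tilde X+nT\tilde H)^\dagger\,(e_{t'}\otimes X_{\hat S}^\top)\bigr],$$ where $\dagger$ denotes the Moore–Penrose inverse. **Theorem.** Let $b=b_n\in\mathbb R^T$ be deterministic with $\|b\|_2=1$. Then, as $n\to\infty$, the matrix $I_T-\hat A/n$ is invertible with probability tending to $1$, and $$\frac1n\,\bigl\|(Y-X\hat B)(I_T-\hat A/n)^{-1}b\bigr\|_2^2\ \longrightarrow\ \sigma^2\quad\text{in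 probability.}$$ Consequently, let $\alpha\in(0,1)$, let $z_{\alpha/2}$ be the standard normal quantile of order $1-\alpha/2$, and let $a=a_n\in\mathbb R^p$ be deterministic with $\|\Sigma^{-1/2}a\|_2=1$. Put $z_0=X\Sigma^{-1}a$. The confidence interval $[L_-,L_+]$ for $a^\top B^*b$ (for $b=e_1$, for the functional $a^\top B^*e_1$ of the first task), where $$L_\pm=a^\top\hat Bb+\frac{z_0^\top(Y-X\hat B)(I_T-\hat A/n)^{-1}b}{n}\pm\frac{z_{\alpha/2}\,\|(Y-X\hat B)(I_T-\hat A/n)^{-1}b\|_2}{n},$$ has length asymptotically equal to $2z_{\alpha/2}\sigma n^{-1/2}$, in the sense that $$\frac{L_+-L_-}{2z_{\alpha/2}\,\sigma\,n^{-1/2}}\ \longrightarrow\ 1\quad\text{in probability.}$$ -/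

import Mathlib

open Matrix MeasureTheory ProbabilityTheory Filter Topology
open scoped Kronecker

namespace MultiTask

/-- The Euclidean norm of a coordinate vector. -/
noncomputable def l2 {ι : Type*} [Fintype ι] (v : ι → ℝ) : ℝ := ‖WithLp.toLp 2 v‖

/-- The squared Frobenius norm. -/
def frobSq {ι κ : Type*} [Fintype ι] [Fintype κ] (M : Matrix ι κ ℝ) : ℝ :=
  ∑ i, ∑ j, M i j ^ 2

/-! ### Moore-Penrose inverse -/

/-- `G` satisfies the four Penrose equations for `A`. -/
structure IsMoorePenrose {ι κ : Type*} [Fintype ι] [Fintype κ]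
    (A : Matrix ι κ ℝ) (G : Matrix κ ι ℝ) : Prop where
  mul_mul_self : A * G * A = A
  self_mul_mul : G * A * G = G
  symm_left : (A * G)ᵀ = A * G
  symm_right : (G * A)ᵀ = G * A

theorem IsMoorePenrose.unique {ι κ : Type*} [Fintype ι] [Fintype κ]
    {A : Matrix ι κ ℝ} {G H : Matrix κ ι ℝ}
    (hG : IsMoorePenrose A G) (hH : IsMoorePenrose A H) : G = H := by
  have h1 : A * G = A * H := by
    calc A * G = (A * G)ᵀ := hG.symm_left.symm
      _ = ((A * H) * (A * G))ᵀ := by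
          rw [← Matrix.mul_assoc (A * H) A G, hH.mul_mul_self]
      _ = (A * G)ᵀ * (A * H)ᵀ := Matrix.transpose_mul _ _
      _ = (A * G) * (A * H) := by rw [hG.symm_left, hH.symm_left]
      _ = A * H := by rw [← Matrix.mul_assoc (A * G) A H, hG.mul_mul_self]
  have h2 : G * A = H * A := by
    calc G * A = (G * A)ᵀ := hG.symm_right.symm
      _ = ((G * A) * (H * A))ᵀ := by
          rw [Matrix.mul_assoc G A (H * A), ← Matrix.mul_assoc A H A, hH.mul_mul_self]
      _ = (H * A)ᵀ * (G * A)ᵀ := Matrix.transpose_mul _ _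
      _ = (H * A) * (G * A) := by rw [hG.symm_right, hH.symm_right]
      _ = H * A := by
          rw [Matrix.mul_assoc H A (G * A), ← Matrix.mul_assoc A G A, hG.mul_mul_self]
  calc G = G * A * G := hG.self_mul_mul.symm
    _ = H * A * G := by rw [h2]
    _ = H * (A * H) := by rw [Matrix.mul_assoc, h1]
    _ = H := by rw [← Matrix.mul_assoc, hH.self_mul_mul]

theorem exists_isMoorePenrose_of_symm {ι : Type*} [Fintype ι]
    {S : Matrix ι ι ℝ} (hS : S.IsHermitian) :
    ∃ G : Matrix ι ι ℝ, IsMoorePenrose S G ∧ Gᵀ = G := by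
  classical
  obtain ⟨U, d, hU, hSd⟩ : ∃ (U : Matrix ι ι ℝ) (d : ι → ℝ), Uᵀ * U = 1 ∧
      S = U * diagonal d * Uᵀ := by
    refine ⟨(hS.eigenvectorUnitary : Matrix ι ι ℝ), hS.eigenvalues, ?_, ?_⟩
    · have := Unitary.coe_star_mul_self hS.eigenvectorUnitary
      simpa [star_eq_conjTranspose] using this
    · have := hS.spectral_theorem
      simpa [Unitary.conjStarAlgAut_apply, star_eq_conjTranspose, Function.comp_def] using this
  have key : ∀ e f : ι → ℝ, (U * diagonal e * Uᵀ) * (U * diagonal f * Uᵀ)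
      = U * diagonal (fun i => e i * f i) * Uᵀ := by
    intro e f
    calc (U * diagonal e * Uᵀ) * (U * diagonal f * Uᵀ)
        = U * diagonal e * (Uᵀ * U) * diagonal f * Uᵀ := by simp only [Matrix.mul_assoc]
      _ = U * diagonal (fun i => e i * f i) * Uᵀ := by
          rw [hU, Matrix.mul_one, Matrix.mul_assoc U, diagonal_mul_diagonal]
  have tr : ∀ e : ι → ℝ, (U * diagonal e * Uᵀ)ᵀ = U * diagonal e * Uᵀ := by
    intro e
    simp [Matrix.transpose_mul, Matrix.mul_assoc]
  refine ⟨U * diagonal (fun i => (d i)⁻¹) * Uᵀ, ⟨?_, ?_, ?_, ?_⟩, tr _⟩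
  · rw [hSd, key, key]
    congr 3
    funext i
    exact mul_inv_mul_cancel (d i)
  · rw [hSd, key, key]
    congr 3
    funext i
    by_cases h : d i = 0 <;> simp [h]
  · rw [hSd, key, tr]
  · rw [hSd, key, tr]

theorem exists_isMoorePenrose {ι κ : Type*} [Fintype ι] [Fintype κ] (A : Matrix ι κ ℝ) :
    ∃ G : Matrix κ ι ℝ, IsMoorePenrose A G := by
  have hS : (Aᵀ * A).IsHermitian := by
    simp [Matrix.IsHermitian, conjTranspose_eq_transpose_of_trivial]
  obtain ⟨G, hG, hGt⟩ := exists_isMoorePenrose_of_symm hS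
  have hA : A * G * (Aᵀ * A) = A := by
    have h0 : Aᵀ * (A * G * (Aᵀ * A) - A) = 0 := by
      have h := hG.mul_mul_self
      simp only [Matrix.mul_assoc] at h ⊢
      rw [Matrix.mul_sub, h, sub_self]
    have h1 : (A * G * (Aᵀ * A) - A)ᵀ * (A * G * (Aᵀ * A) - A) = 0 := by
      have : (A * G * (Aᵀ * A) - A)ᵀ = (G * (Aᵀ * A))ᵀ * Aᵀ - Aᵀ := by
        rw [Matrix.transpose_sub, Matrix.mul_assoc A G, Matrix.transpose_mul]
      rw [this, Matrix.sub_mul, Matrix.mul_assoc, h0, Matrix.mul_zero, sub_zero]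
    have h2 : A * G * (Aᵀ * A) - A = 0 := by
      rw [← conjTranspose_eq_transpose_of_trivial] at h1
      exact Matrix.conjTranspose_mul_self_eq_zero.mp h1
    exact sub_eq_zero.mp h2
  refine ⟨G * Aᵀ, ⟨?_, ?_, ?_, ?_⟩⟩
  · simpa only [Matrix.mul_assoc] using hA
  · have := congrArg (fun M => M * Aᵀ) hG.self_mul_mul
    simpa only [Matrix.mul_assoc] using this
  · simp [Matrix.transpose_mul, Matrix.mul_assoc, hGt]
  · have := hG.symm_right
    simpa only [Matrix.mul_assoc] using this

/-- The Moore-Penrose inverse of a real matrix. -/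
noncomputable def pinv {ι κ : Type*} [Fintype ι] [Fintype κ] (A : Matrix ι κ ℝ) :
    Matrix κ ι ℝ := (exists_isMoorePenrose A).choose

theorem pinv_spec {ι κ : Type*} [Fintype ι] [Fintype κ] (A : Matrix ι κ ℝ) :
    IsMoorePenrose A (pinv A) := (exists_isMoorePenrose A).choose_spec

/-! ### Multi-task Lasso and its interaction matrix -/

section Lasso

variable {n p T : ℕ}

/-- The objective `‖Y - X B‖_F² / (2 n T) + lam * ‖B‖_{2,1}`. -/
noncomputable def objective (X : Matrix (Fin n) (Fin p) ℝ) (Y : Matrix (Fin n) (Fin T) ℝ)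
    (lam : ℝ) (B : Matrix (Fin p) (Fin T) ℝ) : ℝ :=
  1 / (2 * (n : ℝ) * (T : ℝ)) * frobSq (Y - X * B) + lam * ∑ j, l2 (B j)

/-- `B` is a multi-task Lasso estimate, that is a minimizer of the objective. -/
def IsMultiTaskLasso (X : Matrix (Fin n) (Fin p) ℝ) (Y : Matrix (Fin n) (Fin T) ℝ)
    (lam : ℝ) (B : Matrix (Fin p) (Fin T) ℝ) : Prop :=
  ∀ B' : Matrix (Fin p) (Fin T) ℝ, objective X Y lam B ≤ objective X Y lam B'

open Classical in
/-- The set of indices of the nonzero rows. -/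
noncomputable def rowSupport (B : Matrix (Fin p) (Fin T) ℝ) : Finset (Fin p) :=
  Finset.univ.filter fun j => B j ≠ 0

/-- `X` with the columns outside `S` replaced by zero. -/
def restrictCols (X : Matrix (Fin n) (Fin p) ℝ) (S : Finset (Fin p)) :
    Matrix (Fin n) (Fin p) ℝ :=
  Matrix.of fun i j => if j ∈ S then X i j else 0

/-- The Hessian of `u ↦ lam * ‖u‖₂` at the (nonzero) vector `u`. -/
noncomputable def hessBlock (lam : ℝ) (u : Fin T → ℝ) : Matrix (Fin T) (Fin T) ℝ :=
  (lam * (l2 u)⁻¹) • (1 - ((l2 u) ^ 2)⁻¹ • Matrix.vecMulVec u u)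

/-- The matrix `∑_{j ∈ S} H⁽ʲ⁾ ⊗ (e_j e_jᵀ)`, where `S` is the row support of `B`. -/
noncomputable def tildeH (lam : ℝ) (B : Matrix (Fin p) (Fin T) ℝ) :
    Matrix (Fin T × Fin p) (Fin T × Fin p) ℝ :=
  ∑ j ∈ rowSupport B, hessBlock lam (B j) ⊗ₖ Matrix.single j j (1 : ℝ)

/-- The matrix `I_T ⊗ X_S`, where `S` is the row support of `B`. -/
noncomputable def tildeX (X : Matrix (Fin n) (Fin p) ℝ) (B : Matrix (Fin p) (Fin T) ℝ) :
    Matrix (Fin T × Fin n) (Fin T × Fin p) ℝ :=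
  (1 : Matrix (Fin T) (Fin T) ℝ) ⊗ₖ restrictCols X (rowSupport B)

/-- The block row `[0 | X_S | 0]` with `X_S` in block `t`, where `S` is the row support of `B`. -/
noncomputable def blockRow (X : Matrix (Fin n) (Fin p) ℝ) (B : Matrix (Fin p) (Fin T) ℝ)
    (t : Fin T) : Matrix (Fin n) (Fin T × Fin p) ℝ :=
  Matrix.of fun i q => if q.1 = t then restrictCols X (rowSupport B) i q.2 else 0

/-- The interaction matrix of the estimate `B` with tuning parameter `lam`. -/
noncomputable def interaction (X : Matrix (Fin n) (Fin p) ℝ) (lam : ℝ)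
    (B : Matrix (Fin p) (Fin T) ℝ) : Matrix (Fin T) (Fin T) ℝ :=
  Matrix.of fun t t' =>
    Matrix.trace (blockRow X B t
      * pinv ((tildeX X B)ᵀ * tildeX X B + ((n : ℝ) * (T : ℝ)) • tildeH lam B)
      * (blockRow X B t')ᵀ)

/-- The matrix `I_T - A / n`, where `A` is the interaction matrix. -/
noncomputable def adjustment (X : Matrix (Fin n) (Fin p) ℝ) (lam : ℝ)
    (B : Matrix (Fin p) (Fin T) ℝ) : Matrix (Fin T) (Fin T) ℝ :=
  1 - (n : ℝ)⁻¹ • interaction X lam B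

/-- The vector `(Y - X B) (I_T - A / n)⁻¹ b`. -/
noncomputable def adjustedResidual (X : Matrix (Fin n) (Fin p) ℝ)
    (Y : Matrix (Fin n) (Fin T) ℝ) (lam : ℝ) (B : Matrix (Fin p) (Fin T) ℝ)
    (b : Fin T → ℝ) : Fin n → ℝ :=
  ((Y - X * B) * (adjustment X lam B)⁻¹) *ᵥ b

/-- The midpoint `aᵀ B b + z₀ᵀ (Y - X B) (I_T - A / n)⁻¹ b / n`, with `z₀ = X Sig⁻¹ a`. -/
noncomputable def ciCenter (X : Matrix (Fin n) (Fin p) ℝ) (Y : Matrix (Fin n) (Fin T) ℝ)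
    (lam : ℝ) (B : Matrix (Fin p) (Fin T) ℝ) (Sig : Matrix (Fin p) (Fin p) ℝ)
    (a : Fin p → ℝ) (b : Fin T → ℝ) : ℝ :=
  a ⬝ᵥ (B *ᵥ b) + (X *ᵥ (Sig⁻¹ *ᵥ a)) ⬝ᵥ adjustedResidual X Y lam B b / n

/-- The lower end point of the confidence interval for `aᵀ B* b` with normal quantile `z`. -/
noncomputable def ciLower (X : Matrix (Fin n) (Fin p) ℝ) (Y : Matrix (Fin n) (Fin T) ℝ)
    (lam : ℝ) (B : Matrix (Fin p) (Fin T) ℝ) (Sig : Matrix (Fin p) (Fin p) ℝ)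
    (a : Fin p → ℝ) (b : Fin T → ℝ) (z : ℝ) : ℝ :=
  ciCenter X Y lam B Sig a b - z * l2 (adjustedResidual X Y lam B b) / n

/-- The upper end point of the confidence interval for `aᵀ B* b` with normal quantile `z`. -/
noncomputable def ciUpper (X : Matrix (Fin n) (Fin p) ℝ) (Y : Matrix (Fin n) (Fin T) ℝ)
    (lam : ℝ) (B : Matrix (Fin p) (Fin T) ℝ) (Sig : Matrix (Fin p) (Fin p) ℝ)
    (a : Fin p → ℝ) (b : Fin T → ℝ) (z : ℝ) : ℝ :=
  ciCenter X Y lam B Sig a b + z * l2 (adjustedResidual X Y lam B b) / n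

end Lasso

/-- The base tuning parameter
`(1 + η₁) σ max_j Sig_jj^{1/2} (n T)^{-1/2} (1 + ((2 / T) log (p / s))^{1/2})`. -/
noncomputable def lambda0 (η₁ σ : ℝ) (n p T s : ℕ) (Sig : Matrix (Fin p) (Fin p) ℝ) : ℝ :=
  (1 + η₁) * σ * (⨆ j, √(Sig j j)) / √((n : ℝ) * (T : ℝ))
    * (1 + √(2 / (T : ℝ) * Real.log ((p : ℝ) / (s : ℝ))))

/-- The quantile of order `q` of the standard normal distribution. -/
noncomputable def stdNormalQuantile (q : ℝ) : ℝ :=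
  sInf {x : ℝ | q ≤ cdf (gaussianReal 0 1) x}

/-- Convergence in probability to a constant, for random variables `Z n` that may live on
different probability spaces. -/
def TendstoInProb {Ω : ℕ → Type*} [∀ n, MeasurableSpace (Ω n)] (P : ∀ n, Measure (Ω n))
    (Z : ∀ n, Ω n → ℝ) (c : ℝ) : Prop :=
  ∀ ε : ℝ, 0 < ε → Tendsto (fun n => P n {ω | ε < |Z n ω - c|}) atTop (𝓝 0)

/-- The Gaussian design and noise model: `X` has i.i.d. `N(0, Sig)` rows, `E` has i.i.d.
`N(0, σ²)` entries, and `X` and `E` are independent. -/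
structure GaussianModel {Ω : Type*} [MeasurableSpace Ω] (P : Measure Ω) {n p T : ℕ}
    (X : Ω → Matrix (Fin n) (Fin p) ℝ) (E : Ω → Matrix (Fin n) (Fin T) ℝ)
    (Sig : Matrix (Fin p) (Fin p) ℝ) (σ : ℝ) : Prop where
  rows_law : ∀ i, HasLaw (fun ω => WithLp.toLp 2 (X ω i)) (multivariateGaussian 0 Sig) P
  rows_indep : iIndepFun (fun (i : Fin n) ω => WithLp.toLp 2 (X ω i)) P
  entries_law : ∀ i t, HasLaw (fun ω => E ω i t) (gaussianReal 0 (Real.toNNReal (σ ^ 2))) P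
  entries_indep : iIndepFun (fun (it : Fin n × Fin T) ω => E ω it.1 it.2) P
  indep : IndepFun (fun ω (i : Fin n) (j : Fin p) => X ω i j)
    (fun ω (i : Fin n) (t : Fin T) => E ω i t) P

end MultiTask

/-! Write `D = Bhat - Bstar`, `v = (I - A/n)⁻¹ b` and `L = log (p/s)`, and let `ρ` be the rate
`(s/n)(T + L)`. The adjusted residual is `E b + E (v - b) - X D v`. The first term has norm close to
`σ √n` by chi-square concentration; the theorem says that the other two are `o(√n)`.

The term `E (v - b)`: `A` is positive semidefinite with operator norm at most the number of active
rows of `Bhat` (`interaction_quadForm`), because `yᵀ A y` is the trace of a matrix of rank at most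
that number and of norm at most `‖y‖²`. If `Bhat` has at most `K s` active rows, then `‖v - b‖ ≤ 2 K
s / n`, and a crude bound on `‖E‖_F` suffices. The term `X D v`: `‖X D‖_F² / n` is of order `ρ`
(`prediction_bound`).

Both Lasso facts, prediction and sparsity (`card_rowSupport_lt`), are deterministic consequences of
two properties. First, `X` is nearly an isometry on sums of `K s` signed basis vectors. This is a
finite union bound, and `quadForm_transfer`, a derandomized Maurey argument, extends it to all
vectors at the price of an `ℓ¹` term. Second, although `λ₀` carries `log (p/s)` and not `log p`, so
that some rows of `Xᵀ E` may exceed the threshold `τ = n T λ₀`, the total squared excess is at most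
`s τ²` (`measure_excess_le`). That event fails with probability at most `1 / L` plus the failure of
a column norm bound, and `L → ∞` because `ρ ≥ s/n ≥ s/p`.

The interval length divided by its target equals `‖adjusted residual‖ / (√n σ)`, so the last claim
is the same limit. -/

namespace MultiTask

/-! ### Independent centred Gaussian variables -/

/-- Independent centred Gaussian variables with common variance `w`. -/
structure IsGaussianFamily {Ω ι : Type*} [MeasurableSpace Ω] (P : Measure Ω) (ξ : ι → Ω → ℝ)
    (w : ℝ) : Prop where
  nonneg : 0 ≤ w
  law : ∀ i, HasLaw (ξ i) (gaussianReal 0 w.toNNReal) P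
  indep : iIndepFun ξ P

theorem lintegral_exp_sq_gaussianReal {w θ : ℝ} (hw : 0 ≤ w) (h : 2 * θ * w < 1) :
    ∫⁻ x, ENNReal.ofReal (Real.exp (θ * x ^ 2)) ∂(gaussianReal 0 w.toNNReal)
      = ENNReal.ofReal ((√(1 - 2 * θ * w))⁻¹) := by
  rcases hw.eq_or_lt with rfl | hw
  · simp
  have hv : w.toNNReal ≠ 0 := by simpa using hw
  rw [gaussianReal_of_var_ne_zero _ hv, lintegral_withDensity_eq_lintegral_mul _
    (measurable_gaussianPDF _ _) (by fun_prop)]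
  -- The Gaussian density times `exp (θ x²)` is again a Gaussian kernel `exp (-β x²)`, with `β > 0`
  -- exactly when `2 θ w < 1`.
  set β : ℝ := (1 - 2 * θ * w) / (2 * w) with hβ
  have hβ0 : 0 < β := div_pos (by linarith) (by linarith)
  have h1 : ∀ x : ℝ, (gaussianPDF 0 w.toNNReal * fun x => ENNReal.ofReal (Real.exp (θ * x ^ 2))) x
      = ENNReal.ofReal ((√(2 * Real.pi * w))⁻¹ * Real.exp (-β * x ^ 2)) := by
    intro x
    rw [Pi.mul_apply, gaussianPDF, ← ENNReal.ofReal_mul (gaussianPDFReal_nonneg _ _ _),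
      gaussianPDFReal, Real.coe_toNNReal _ hw.le, mul_assoc, ← Real.exp_add]
    congr 3
    rw [hβ]
    field_simp
    ring
  simp_rw [h1]
  rw [← ofReal_integral_eq_lintegral_ofReal ((integrable_exp_neg_mul_sq hβ0).const_mul _)
    (Eventually.of_forall fun x => by positivity), integral_const_mul, integral_gaussian]
  congr 1
  rw [← Real.sqrt_inv, ← Real.sqrt_mul (by positivity), ← Real.sqrt_inv]
  congr 1
  rw [hβ]
  have : (1 - 2 * θ * w) ≠ 0 := by linarith
  field_simp

namespace IsGaussianFamily

variable {Ω ι : Type*} [MeasurableSpace Ω] {P : Measure Ω} {ξ : ι → Ω → ℝ} {w : ℝ}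

theorem aemeasurable (hξ : IsGaussianFamily P ξ w) (i : ι) : AEMeasurable (ξ i) P :=
  (hξ.law i).aemeasurable

theorem memLp (hξ : IsGaussianFamily P ξ w) (i : ι) : MemLp (ξ i) 2 P := by
  have := (hξ.law i).hasGaussianLaw
  exact this.memLp_two

variable [Fintype ι]

/-- The variables are only a.e. measurable, so the product formula for independent functions is
applied to measurable modifications. -/
theorem lintegral_prod_comp {f : ℝ → ENNReal}
    (hξ : IsGaussianFamily P ξ w) (hf : Measurable f) :
    ∫⁻ ω, ∏ i, f (ξ i ω) ∂P = (∫⁻ x, f x ∂(gaussianReal 0 w.toNNReal)) ^ Fintype.card ι := by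
  have hm : ∀ i, AEMeasurable (ξ i) P := fun i => (hξ.law i).aemeasurable
  have h2 : ∀ i, ξ i =ᵐ[P] (hm i).mk _ := fun i => (hm i).ae_eq_mk
  have hi : iIndepFun (fun i => f ∘ (hm i).mk (ξ i)) P :=
    (hξ.indep.congr h2).comp (fun _ => f) fun _ => hf
  have h3 : ∫⁻ ω, ∏ i, f (ξ i ω) ∂P = ∫⁻ ω, ∏ i, (f ∘ (hm i).mk (ξ i)) ω ∂P := by
    refine lintegral_congr_ae ?_
    filter_upwards [ae_all_iff.2 h2] with ω hω
    simp [hω]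
  rw [h3, lintegral_prod_eq_prod_lintegral_of_indepFun _ _ hi
    fun i => hf.comp (hm i).measurable_mk]
  have h4 : ∀ i, ∫⁻ ω, (f ∘ (hm i).mk (ξ i)) ω ∂P = ∫⁻ x, f x ∂(gaussianReal 0 w.toNNReal) := by
    intro i
    rw [← (hξ.law i).lintegral_comp hf.aemeasurable]
    refine lintegral_congr_ae ?_
    filter_upwards [h2 i] with ω hω
    simp [hω]
  rw [Finset.prod_congr rfl fun i _ => h4 i, Finset.prod_const, Finset.card_univ]

theorem lintegral_exp_sum_sq (hξ : IsGaussianFamily P ξ w) {θ : ℝ} (h : 2 * θ * w < 1) :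
    ∫⁻ ω, ENNReal.ofReal (Real.exp (θ * ∑ i, ξ i ω ^ 2)) ∂P
      = ENNReal.ofReal ((√(1 - 2 * θ * w))⁻¹ ^ Fintype.card ι) := by
  have h1 : ∀ ω, ENNReal.ofReal (Real.exp (θ * ∑ i, ξ i ω ^ 2))
      = ∏ i, ENNReal.ofReal (Real.exp (θ * ξ i ω ^ 2)) := by
    intro ω
    rw [Finset.mul_sum, Real.exp_sum, ENNReal.ofReal_prod_of_nonneg fun _ _ => by positivity]
  simp_rw [h1]
  rw [hξ.lintegral_prod_comp (f := fun x => ENNReal.ofReal (Real.exp (θ * x ^ 2))) (by fun_prop),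
    lintegral_exp_sq_gaussianReal hξ.nonneg h, ENNReal.ofReal_pow (by positivity)]

/-- After taking logarithms this is `log a ≤ a - 1`, since `a - 1 - (a² - 1)/2 = -(a - 1)²/2`. -/
theorem inv_sqrt_pow_mul_exp_le {a : ℝ} (ha : 0 < a) (N : ℕ) :
    a ^ N * Real.exp (-((1 - (a ^ 2)⁻¹) / 2 * (N * a ^ 2))) ≤
      Real.exp (-(N * (a - 1) ^ 2 / 2)) := by
  have h1 : a ^ N = Real.exp (N * Real.log a) := by
    rw [mul_comm, Real.exp_mul, Real.exp_log ha, Real.rpow_natCast]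
  rw [h1, ← Real.exp_add]
  refine Real.exp_le_exp.2 ?_
  have h2 := Real.log_le_sub_one_of_pos ha
  have h3 : (1 - (a ^ 2)⁻¹) / 2 * (N * a ^ 2) = N * ((a ^ 2 - 1) / 2) := by
    field_simp
  rw [h3]
  nlinarith [mul_le_mul_of_nonneg_left h2 (Nat.cast_nonneg (α := ℝ) N)]

/-- Chernoff's bound for a chi-square variable, with the exponent optimal at level `a ^ 2`. The
variance `w` of the variables and the variance `v` in the exponent may differ as long as
the exponential moment increases when `w` is replaced by `v`. -/
theorem lintegral_exp_chernoff (hξ : IsGaussianFamily P ξ w) {a v : ℝ} (ha : 0 < a)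
    (hv : 0 < v) (h : (1 - (a ^ 2)⁻¹) * w ≤ (1 - (a ^ 2)⁻¹) * v) :
    ∫⁻ ω, ENNReal.ofReal (Real.exp ((1 - (a ^ 2)⁻¹) / (2 * v) *
        (∑ i, ξ i ω ^ 2 - v * Fintype.card ι * a ^ 2))) ∂P
      ≤ ENNReal.ofReal (Real.exp (-(Fintype.card ι * (a - 1) ^ 2 / 2))) := by
  set θ := (1 - (a ^ 2)⁻¹) / (2 * v) with hθ
  have hθv : 2 * θ * v = 1 - (a ^ 2)⁻¹ := by rw [hθ]; field_simp
  have hθw : 2 * θ * w ≤ 2 * θ * v := by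
    have : θ * w ≤ θ * v := by
      rw [hθ, div_mul_eq_mul_div, div_mul_eq_mul_div]
      gcongr
    linarith
  have ha2 : 0 < (a ^ 2)⁻¹ := by positivity
  have h1 : ∀ ω, ENNReal.ofReal (Real.exp (θ * (∑ i, ξ i ω ^ 2 - v * Fintype.card ι * a ^ 2)))
      = ENNReal.ofReal (Real.exp (-(θ * (v * Fintype.card ι * a ^ 2)))) *
        ENNReal.ofReal (Real.exp (θ * ∑ i, ξ i ω ^ 2)) := by
    intro ω
    rw [← ENNReal.ofReal_mul (by positivity), ← Real.exp_add]
    congr 2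
    ring
  simp_rw [h1]
  rw [lintegral_const_mul' _ _ ENNReal.ofReal_ne_top, hξ.lintegral_exp_sum_sq (by linarith),
    ← ENNReal.ofReal_mul (by positivity)]
  refine ENNReal.ofReal_le_ofReal ?_
  have h2 : (√(1 - 2 * θ * w))⁻¹ ≤ a := by
    rw [inv_le_comm₀ (Real.sqrt_pos.2 (by linarith)) ha]
    refine Real.le_sqrt_of_sq_le ?_
    rw [inv_pow]
    linarith
  calc _ ≤ Real.exp (-(θ * (v * Fintype.card ι * a ^ 2))) * a ^ Fintype.card ι := by gcongr
    _ = a ^ Fintype.card ι * Real.exp (-((1 - (a ^ 2)⁻¹) / 2 * (Fintype.card ι * a ^ 2))) := by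
      rw [mul_comm]
      congr 3
      rw [hθ]
      field_simp
    _ ≤ _ := inv_sqrt_pow_mul_exp_le ha _

theorem aemeasurable_sum_sq (hξ : IsGaussianFamily P ξ w) :
    AEMeasurable (fun ω => ∑ i, ξ i ω ^ 2) P :=
  Finset.aemeasurable_fun_sum _ fun i _ => (hξ.law i).aemeasurable.pow_const 2

/-- Two-sided chi-square deviation: the event is an upper deviation when `1 ≤ a` and a lower
one when `a ≤ 1`. -/
theorem measure_deviation_le (hξ : IsGaussianFamily P ξ w) {a : ℝ} (ha : 0 < a) (hw : 0 < w) :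
    P {ω | 0 ≤ (a - 1) * (∑ i, ξ i ω ^ 2 - w * Fintype.card ι * a ^ 2)}
      ≤ ENNReal.ofReal (Real.exp (-(Fintype.card ι * (a - 1) ^ 2 / 2))) := by
  refine le_trans ?_ (hξ.lintegral_exp_chernoff ha hw le_rfl)
  have hm : AEMeasurable (fun ω => ENNReal.ofReal (Real.exp ((1 - (a ^ 2)⁻¹) / (2 * w) *
        (∑ i, ξ i ω ^ 2 - w * Fintype.card ι * a ^ 2)))) P :=
    (Real.measurable_exp.comp_aemeasurable
      ((hξ.aemeasurable_sum_sq.sub_const _).const_mul _)).ennreal_ofReal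
  have h := mul_meas_ge_le_lintegral₀ hm 1
  rw [one_mul] at h
  refine le_trans (measure_mono ?_) h
  intro ω hω
  simp only [Set.mem_ofPred_eq] at hω ⊢
  rw [← ENNReal.ofReal_one]
  refine ENNReal.ofReal_le_ofReal (Real.one_le_exp ?_)
  -- The Chernoff exponent has the sign of `a - 1`, so one computation serves both tails.
  have h3 : (1 - (a ^ 2)⁻¹) / (2 * w) = (a + 1) / (2 * w * a ^ 2) * (a - 1) := by
    field_simp
    ring
  rw [h3, mul_assoc]
  exact mul_nonneg (by positivity) hω

theorem measure_upper_le (hξ : IsGaussianFamily P ξ w) {a : ℝ} (ha : 1 ≤ a) (hw : 0 < w) :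
    P {ω | w * Fintype.card ι * a ^ 2 < ∑ i, ξ i ω ^ 2}
      ≤ ENNReal.ofReal (Real.exp (-(Fintype.card ι * (a - 1) ^ 2 / 2))) := by
  refine le_trans (measure_mono fun ω hω => ?_) (hξ.measure_deviation_le (by linarith) hw)
  simp only [Set.mem_ofPred_eq] at hω ⊢
  exact mul_nonneg (sub_nonneg.2 ha) (sub_nonneg.2 (le_of_lt hω))

theorem measure_lower_le (hξ : IsGaussianFamily P ξ w) {a : ℝ} (ha : 0 < a) (ha1 : a ≤ 1)
    (hw : 0 < w) :
    P {ω | ∑ i, ξ i ω ^ 2 < w * Fintype.card ι * a ^ 2}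
      ≤ ENNReal.ofReal (Real.exp (-(Fintype.card ι * (a - 1) ^ 2 / 2))) := by
  refine le_trans (measure_mono fun ω hω => ?_) (hξ.measure_deviation_le ha hw)
  simp only [Set.mem_ofPred_eq] at hω ⊢
  exact mul_nonneg_of_nonpos_of_nonpos (sub_nonpos.2 ha1) (sub_nonpos.2 (le_of_lt hω))

/-- Linear combinations of a Gaussian family with orthogonal coefficient vectors of a common
length form a Gaussian family. -/
theorem linear {κ : Type*} [Fintype κ] [DecidableEq κ] [IsProbabilityMeasure P]
    (hξ : IsGaussianFamily P ξ w) (C : Matrix κ ι ℝ) {v : ℝ} (hv : 0 ≤ v)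
    (hC : C * Cᵀ = v • (1 : Matrix κ κ ℝ)) :
    IsGaussianFamily P (fun k ω => ∑ i, C k i * ξ i ω) (w * v) := by
  classical
  have hL : HasGaussianLaw (fun ω => (ξ · ω)) P :=
    iIndepFun.hasGaussianLaw (fun i => (hξ.law i).hasGaussianLaw) hξ.indep
  have hG : HasGaussianLaw (fun ω k => ∑ i, C k i * ξ i ω) P := by
    have := hL.map_fun (LinearMap.toContinuousLinearMap (Matrix.mulVecLin C))
    exact this
  have hvar : ∀ i, Var[ξ i; P] = w := by
    intro i
    rw [(hξ.law i).variance_eq, variance_id_gaussianReal, Real.coe_toNNReal _ hξ.nonneg]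
  have hmean : ∀ i, ∫ ω, ξ i ω ∂P = 0 := by
    intro i
    rw [(hξ.law i).integral_eq]
    exact integral_id_gaussianReal
  have hcovξ : ∀ i j, cov[ξ i, ξ j; P] = if i = j then w else 0 := by
    intro i j
    split_ifs with h
    · subst h
      rw [covariance_self (hξ.aemeasurable i), hvar]
    · exact (hξ.indep.indepFun h).covariance_eq_zero (hξ.memLp i) (hξ.memLp j)
  have hmem : ∀ k i, MemLp (fun ω => C k i * ξ i ω) 2 P := fun k i => (hξ.memLp i).const_mul _
  have hcov : ∀ k l, cov[fun ω => ∑ i, C k i * ξ i ω, fun ω => ∑ i, C l i * ξ i ω; P]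
      = if k = l then w * v else 0 := by
    intro k l
    rw [covariance_fun_sum_fun_sum (fun i => hmem k i) (fun i => hmem l i)]
    have h1 : ∀ i j, cov[fun ω => C k i * ξ i ω, fun ω => C l j * ξ j ω; P]
        = if i = j then w * (C k i * C l i) else 0 := by
      intro i j
      rw [covariance_const_mul_left, covariance_const_mul_right, hcovξ]
      split_ifs with h
      · subst h; ring
      · simp
    simp_rw [h1]
    have h2 := congrFun (congrFun hC k) l
    rw [Matrix.mul_apply] at h2
    simp only [transpose_apply, Matrix.smul_apply, one_apply, smul_eq_mul, mul_ite, mul_one,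
      mul_zero] at h2
    simp only [Finset.sum_ite_eq, Finset.mem_univ, if_true]
    rw [← Finset.mul_sum, h2]
    split_ifs <;> simp
  refine ⟨mul_nonneg hξ.nonneg hv, fun k => ?_, ?_⟩
  · have hk := hG.eval k
    refine ⟨hk.aemeasurable, ?_⟩
    rw [hk.map_eq_gaussianReal, integral_finsetSum _ fun i _ => (hmem k i).integrable (by simp)]
    congr 1
    · simp [integral_const_mul, hmean]
    · rw [← covariance_self hk.aemeasurable, hcov, if_pos rfl]
  -- Uncorrelated coordinates are independent because the whole vector is jointly Gaussian.
  · exact HasGaussianLaw.iIndepFun_of_covariance_eq_zero hG fun k l h => by rw [hcov, if_neg h]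

end IsGaussianFamily

/-! ### Euclidean norms -/

theorem l2_sq {ι : Type*} [Fintype ι] (v : ι → ℝ) : l2 v ^ 2 = ∑ i, v i ^ 2 := by
  rw [l2, EuclideanSpace.real_norm_sq_eq]

theorem l2_nonneg {ι : Type*} [Fintype ι] (v : ι → ℝ) : 0 ≤ l2 v := norm_nonneg _

theorem l2_eq_sqrt {ι : Type*} [Fintype ι] (v : ι → ℝ) : l2 v = √(∑ i, v i ^ 2) := by
  rw [← l2_sq, Real.sqrt_sq (l2_nonneg v)]

theorem dotProduct_self_eq_l2_sq {ι : Type*} [Fintype ι] (v : ι → ℝ) : v ⬝ᵥ v = l2 v ^ 2 := by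
  rw [l2_sq]
  simp [dotProduct, sq]

theorem dotProduct_le_l2_mul {ι : Type*} [Fintype ι] (u v : ι → ℝ) :
    u ⬝ᵥ v ≤ l2 u * l2 v := by
  have := real_inner_le_norm (WithLp.toLp 2 v) (WithLp.toLp 2 u)
  rw [EuclideanSpace.inner_eq_star_dotProduct] at this
  simpa [l2, mul_comm] using this

theorem measurable_l2 {ι : Type*} [Fintype ι] : Measurable (l2 : (ι → ℝ) → ℝ) := by
  simp only [funext l2_eq_sqrt]
  fun_prop

/-! ### Quadratic forms with bounded spectrum -/

section Spectrum

variable {ι : Type*} [Fintype ι] [DecidableEq ι] {S : Matrix ι ι ℝ} {c d : ℝ}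

open scoped Pointwise in
theorem le_quadForm_of_spectrum (hS : S.IsHermitian) (h : spectrum ℝ S ⊆ Set.Icc c d)
    (z : ι → ℝ) : c * l2 z ^ 2 ≤ z ⬝ᵥ (S *ᵥ z) := by
  have hH : (S - c • (1 : Matrix ι ι ℝ)).IsHermitian := by
    refine hS.sub ?_
    simp [Matrix.IsHermitian]
  have hP : (S - c • (1 : Matrix ι ι ℝ)).PosSemidef := by
    refine hH.posSemidef_iff_eigenvalues_nonneg.2 fun i => ?_
    have h1 := hH.eigenvalues_mem_spectrum_real i
    have h2 : spectrum ℝ (S - c • (1 : Matrix ι ι ℝ)) = spectrum ℝ S - ({c} : Set ℝ) := by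
      rw [← Algebra.algebraMap_eq_smul_one, ← spectrum.sub_singleton_eq]
    obtain ⟨x, hx, y, rfl, hxy⟩ := h2 ▸ h1
    have := (h hx).1
    simp only [Pi.zero_apply]
    rw [← hxy]
    simpa using this
  have := hP.dotProduct_mulVec_nonneg z
  simp only [star_trivial, sub_mulVec, smul_mulVec, one_mulVec, dotProduct_sub,
    dotProduct_smul, smul_eq_mul, dotProduct_self_eq_l2_sq] at this
  linarith

open scoped Pointwise in
theorem quadForm_le_of_spectrum (hS : S.IsHermitian) (h : spectrum ℝ S ⊆ Set.Icc c d)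
    (z : ι → ℝ) : z ⬝ᵥ (S *ᵥ z) ≤ d * l2 z ^ 2 := by
  have h1 : spectrum ℝ (-S) ⊆ Set.Icc (-d) (-c) := by
    intro x hx
    rw [← spectrum.neg_eq] at hx
    have := h (Set.mem_neg.1 hx)
    exact ⟨by linarith [this.2], by linarith [this.1]⟩
  have := le_quadForm_of_spectrum hS.neg h1 z
  simp only [neg_mulVec, dotProduct_neg] at this
  linarith

theorem posSemidef_of_spectrum (hS : S.IsHermitian) (h : spectrum ℝ S ⊆ Set.Icc c d)
    (hc : 0 ≤ c) : S.PosSemidef :=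
  hS.posSemidef_iff_eigenvalues_nonneg.2 fun i =>
    hc.trans (h (hS.eigenvalues_mem_spectrum_real i)).1

end Spectrum

/-! ### Gaussian families in the model -/

namespace GaussianModel

variable {Ω : Type*} [MeasurableSpace Ω] {P : Measure Ω} {n p T : ℕ}
  {X : Ω → Matrix (Fin n) (Fin p) ℝ} {E : Ω → Matrix (Fin n) (Fin T) ℝ}
  {Sig : Matrix (Fin p) (Fin p) ℝ} {σ : ℝ}

theorem noise_entries (h : GaussianModel P X E Sig σ) :
    IsGaussianFamily P (fun (q : Fin n × Fin T) ω => E ω q.1 q.2) (σ ^ 2) :=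
  ⟨sq_nonneg _, fun q => h.entries_law q.1 q.2, h.entries_indep⟩

theorem design_mulVec (h : GaussianModel P X E Sig σ) (hS : Sig.PosSemidef) (z : Fin p → ℝ) :
    IsGaussianFamily P (fun i ω => (X ω *ᵥ z) i) (z ⬝ᵥ (Sig *ᵥ z)) := by
  set L : StrongDual ℝ (EuclideanSpace ℝ (Fin p)) := innerSL ℝ (WithLp.toLp 2 z) with hL
  have hLX : ∀ i ω, L (WithLp.toLp 2 (X ω i)) = (X ω *ᵥ z) i := by
    intro i ω
    simp [hL, EuclideanSpace.inner_eq_star_dotProduct, mulVec]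
  have hlaw : HasLaw L (gaussianReal 0 (z ⬝ᵥ (Sig *ᵥ z)).toNNReal)
      (multivariateGaussian 0 Sig) := by
    refine ⟨by fun_prop, ?_⟩
    rw [IsGaussian.map_eq_gaussianReal, L.integral_comp_id_comm IsGaussian.integrable_id,
      integral_id_multivariateGaussian, map_zero]
    congr 2
    have := covarianceBilin_self (μ := multivariateGaussian 0 Sig) IsGaussian.memLp_two_id
      (WithLp.toLp 2 z)
    rw [covarianceBilin_multivariateGaussian hS] at this
    exact this.symm
  refine ⟨by simpa using hS.dotProduct_mulVec_nonneg z, fun i => ?_, ?_⟩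
  · have := hlaw.comp (h.rows_law i)
    simpa only [Function.comp_def, hLX] using this
  · have := h.rows_indep.comp (fun _ => L) fun _ => by fun_prop
    simpa only [Function.comp_def, hLX] using this

variable [IsProbabilityMeasure P]

theorem noise_mulVec (h : GaussianModel P X E Sig σ) (b : Fin T → ℝ) :
    IsGaussianFamily P (fun i ω => (E ω *ᵥ b) i) (σ ^ 2 * l2 b ^ 2) := by
  have := h.noise_entries.linear
    (Matrix.of fun (i : Fin n) (q : Fin n × Fin T) => if i = q.1 then b q.2 else 0)
    (v := l2 b ^ 2) (sq_nonneg _) (by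
      ext i j
      rw [Matrix.mul_apply, Fintype.sum_prod_type, l2_sq]
      by_cases hij : i = j
      · subst hij
        simp [sq]
      · simp [hij])
  convert this using 3 with i ω
  rw [Fintype.sum_prod_type]
  simp [mulVec, dotProduct, mul_comm]

/-- For a fixed design, distinct tasks use disjoint noise entries, so the coefficient rows are
orthogonal. The norm of row `j` is thus a scaled chi variable with `T` degrees of freedom. -/
theorem transpose_mul_noise (h : GaussianModel P X E Sig σ) (x : Matrix (Fin n) (Fin p) ℝ)
    (j : Fin p) :
    IsGaussianFamily P (fun t ω => (xᵀ * E ω) j t) (σ ^ 2 * ∑ i, x i j ^ 2) := by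
  have := h.noise_entries.linear
    (Matrix.of fun (t : Fin T) (q : Fin n × Fin T) => if t = q.2 then x q.1 j else 0)
    (v := ∑ i, x i j ^ 2) (Finset.sum_nonneg fun _ _ => sq_nonneg _) (by
      ext t t'
      rw [Matrix.mul_apply, Fintype.sum_prod_type]
      by_cases hij : t = t'
      · subst hij
        simp [sq]
      · simp [hij])
  convert this using 3 with t ω
  rw [Fintype.sum_prod_type]
  simp [Matrix.mul_apply]

end GaussianModel

/-! ### Excess of a Gaussian norm over a threshold -/

/-- For `r ≥ τ`, `(r - τ)² ≤ r² - τ²`, and `u ≤ exp u`. This turns a truncated second moment into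
the exponential moment of Chernoff's bound. -/
theorem sq_posPart_sub_le {r τ θ : ℝ} (hτ : 0 ≤ τ) (hθ : 0 < θ) :
    max (r - τ) 0 ^ 2 ≤ θ⁻¹ * Real.exp (θ * (r ^ 2 - τ ^ 2)) := by
  rcases le_total r τ with h | h
  · rw [max_eq_right (by linarith)]
    simp only [ne_eq, OfNat.ofNat_ne_zero, not_false_eq_true, zero_pow]
    positivity
  · rw [max_eq_left (by linarith)]
    have h1 : (r - τ) ^ 2 ≤ r ^ 2 - τ ^ 2 := by nlinarith
    have h2 := Real.add_one_le_exp (θ * (r ^ 2 - τ ^ 2))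
    rw [← mul_le_mul_iff_right₀ hθ, ← mul_assoc, mul_inv_cancel₀ hθ.ne', one_mul]
    nlinarith [mul_le_mul_of_nonneg_left h1 hθ.le]

theorem IsGaussianFamily.lintegral_excess_le {Ω ι : Type*} [MeasurableSpace Ω] [Fintype ι]
    {P : Measure Ω} {ξ : ι → Ω → ℝ} {w : ℝ} (hξ : IsGaussianFamily P ξ w) {v a : ℝ}
    (hv : 0 < v) (hwv : w ≤ v) (ha : 1 < a) :
    ∫⁻ ω, ENNReal.ofReal (max (l2 (fun i => ξ i ω) - √(v * Fintype.card ι) * a) 0 ^ 2) ∂P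
      ≤ ENNReal.ofReal (2 * v / (1 - (a ^ 2)⁻¹) *
          Real.exp (-(Fintype.card ι * (a - 1) ^ 2 / 2))) := by
  have ha1 : 0 < 1 - (a ^ 2)⁻¹ := by
    have : (a ^ 2)⁻¹ < 1 := inv_lt_one_of_one_lt₀ (by nlinarith)
    linarith
  set θ := (1 - (a ^ 2)⁻¹) / (2 * v) with hθ
  have hθ0 : 0 < θ := by positivity
  have hθi : 2 * v / (1 - (a ^ 2)⁻¹) = θ⁻¹ := by rw [hθ, inv_div]
  rw [hθi]
  calc _ ≤ ∫⁻ ω, ENNReal.ofReal θ⁻¹ * ENNReal.ofReal (Real.exp (θ *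
        (∑ i, ξ i ω ^ 2 - v * Fintype.card ι * a ^ 2))) ∂P := by
        refine lintegral_mono fun ω => ?_
        rw [← ENNReal.ofReal_mul (by positivity)]
        refine ENNReal.ofReal_le_ofReal ?_
        have := sq_posPart_sub_le (r := l2 (fun i => ξ i ω))
          (τ := √(v * Fintype.card ι) * a) (by positivity) hθ0
        rwa [l2_sq, mul_pow, Real.sq_sqrt (by positivity)] at this
    _ ≤ _ := by
        rw [lintegral_const_mul' _ _ ENNReal.ofReal_ne_top, ENNReal.ofReal_mul (by positivity)]
        gcongr
        exact hξ.lintegral_exp_chernoff (by linarith) hv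
          (mul_le_mul_of_nonneg_left hwv ha1.le)

namespace GaussianModel

variable {Ω : Type*} [MeasurableSpace Ω] {P : Measure Ω} {n p T : ℕ}
  {X : Ω → Matrix (Fin n) (Fin p) ℝ} {E : Ω → Matrix (Fin n) (Fin T) ℝ}
  {Sig : Matrix (Fin p) (Fin p) ℝ} {σ : ℝ}

theorem aemeasurable_noise (h : GaussianModel P X E Sig σ) :
    AEMeasurable (fun ω (i : Fin n) (t : Fin T) => E ω i t) P :=
  aemeasurable_pi_lambda _ fun i => aemeasurable_pi_lambda _ fun t => (h.entries_law i t).aemeasurable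

theorem aemeasurable_design (h : GaussianModel P X E Sig σ) :
    AEMeasurable (fun ω (i : Fin n) (j : Fin p) => X ω i j) P :=
  aemeasurable_pi_lambda _ fun i => aemeasurable_pi_lambda _ fun j => by
    have : Measurable fun v : EuclideanSpace ℝ (Fin p) => v j := by fun_prop
    exact this.comp_aemeasurable (h.rows_law i).aemeasurable

variable [IsProbabilityMeasure P]

/-- The total squared excess of the norms of the rows of `xᵀ * e` over the level `τ`. -/
noncomputable def excess (τ : ℝ) (x : Matrix (Fin n) (Fin p) ℝ)
    (e : Matrix (Fin n) (Fin T) ℝ) : ℝ :=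
  ∑ j, max (l2 ((xᵀ * e) j) - τ) 0 ^ 2

/-- Markov's inequality for the total excess. The factor `a = 1 + √(2L/T)` makes the Chernoff
exponent `T (a - 1)²/2` equal to `L`, so the expected excess is at most `p e^{-L} · 2v / (1 - a⁻²)`.
Divided by `r τ²` this is at most `2 / (T (a² - 1)) ≤ 1 / L`. -/
theorem measure_excess_fixed_le (h : GaussianModel P X E Sig σ) (x : Matrix (Fin n) (Fin p) ℝ)
    {v r L : ℝ} (hv : 0 < v) (hx : ∀ j, σ ^ 2 * ∑ i, x i j ^ 2 ≤ v) (hL : 0 < L) (hT : 0 < T)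
    (hr : 0 < r) (hrp : p * Real.exp (-L) ≤ r) :
    P {ω | r * (√(v * T) * (1 + √(2 * L / T))) ^ 2
        < excess (√(v * T) * (1 + √(2 * L / T))) x (E ω)} ≤ ENNReal.ofReal (1 / L) := by
  set a := 1 + √(2 * L / T) with ha
  set τ := √(v * T) * a with hτ
  have hT' : (0 : ℝ) < T := by exact_mod_cast hT
  have hs0 : 0 < √(2 * L / T) := by positivity
  have ha1 : 1 < a := by linarith
  have hasq : T * (a - 1) ^ 2 = 2 * L := by
    rw [ha, add_sub_cancel_left, Real.sq_sqrt (by positivity)]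
    field_simp
  have hτ0 : 0 < τ := by positivity
  have hmE : ∀ j, AEMeasurable (fun ω => ENNReal.ofReal (max (l2 ((xᵀ * E ω) j) - τ) 0 ^ 2)) P := by
    intro j
    have h1 : AEMeasurable (fun ω t => (xᵀ * E ω) j t) P :=
      aemeasurable_pi_lambda _ fun t => (h.transpose_mul_noise x j).aemeasurable t
    have h2 : AEMeasurable (fun ω => l2 ((xᵀ * E ω) j)) P := measurable_l2.comp_aemeasurable h1
    exact (((h2.sub_const τ).max aemeasurable_const).pow_const 2).ennreal_ofReal
  have hI : ∫⁻ ω, ENNReal.ofReal (excess τ x (E ω)) ∂P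
      ≤ ENNReal.ofReal (r * (2 * v / (1 - (a ^ 2)⁻¹))) := by
    simp_rw [excess, ENNReal.ofReal_sum_of_nonneg fun j _ =>
      sq_nonneg (max (l2 ((xᵀ * E _) j) - τ) 0)]
    rw [lintegral_finsetSum' _ fun j _ => hmE j]
    have hb : ∀ j, ∫⁻ ω, ENNReal.ofReal (max (l2 ((xᵀ * E ω) j) - τ) 0 ^ 2) ∂P
        ≤ ENNReal.ofReal (2 * v / (1 - (a ^ 2)⁻¹) * Real.exp (-L)) := by
      intro j
      have := (h.transpose_mul_noise x j).lintegral_excess_le hv (hx j) ha1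
      rw [Fintype.card_fin, hasq, mul_div_cancel_left₀ L two_ne_zero] at this
      exact this
    refine (Finset.sum_le_sum fun j _ => hb j).trans ?_
    rw [Finset.sum_const, Finset.card_univ, Fintype.card_fin, ← ENNReal.ofReal_nsmul]
    refine ENNReal.ofReal_le_ofReal ?_
    have ha2 : 0 < 1 - (a ^ 2)⁻¹ := by
      have : (a ^ 2)⁻¹ < 1 := inv_lt_one_of_one_lt₀ (by nlinarith)
      linarith
    have h0 : 0 ≤ 2 * v / (1 - (a ^ 2)⁻¹) := by positivity
    rw [nsmul_eq_mul]
    nlinarith [mul_le_mul_of_nonneg_left hrp h0]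
  have hm : AEMeasurable (fun ω => ENNReal.ofReal (excess τ x (E ω))) P := by
    simp_rw [excess, ENNReal.ofReal_sum_of_nonneg fun j _ =>
      sq_nonneg (max (l2 ((xᵀ * E _) j) - τ) 0)]
    exact Finset.aemeasurable_fun_sum _ fun j _ => hmE j
  have hM := meas_ge_le_lintegral_div hm (ε := ENNReal.ofReal (r * τ ^ 2))
    (by simpa using by positivity) ENNReal.ofReal_ne_top
  refine (measure_mono fun ω hω => ?_).trans (hM.trans ((ENNReal.div_le_div_right hI _).trans ?_))
  · simp only [Set.mem_ofPred_eq] at hω ⊢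
    exact ENNReal.ofReal_le_ofReal hω.le
  · rw [← ENNReal.ofReal_div_of_pos (by positivity)]
    refine ENNReal.ofReal_le_ofReal ?_
    have h2 : r * τ ^ 2 = r * (v * T * a ^ 2) := by
      rw [hτ, mul_pow, Real.sq_sqrt (by positivity)]
    have h3 : 0 < a ^ 2 - 1 := by nlinarith
    have h4 : 1 - (a ^ 2)⁻¹ = (a ^ 2 - 1) / a ^ 2 := by field_simp
    have h5 : r * (2 * v / (1 - (a ^ 2)⁻¹)) / (r * τ ^ 2) = 2 / (T * (a ^ 2 - 1)) := by
      rw [h2, h4]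
      field_simp
    rw [h5, div_le_div_iff₀ (by positivity) hL]
    nlinarith

theorem measurable_excess (τ : ℝ) :
    Measurable fun q : (Fin n → Fin p → ℝ) × (Fin n → Fin T → ℝ) =>
      excess τ (Matrix.of q.1) (Matrix.of q.2) := by
  refine Finset.measurable_fun_sum _ fun j _ => Measurable.pow_const (Measurable.max
    (Measurable.sub_const (measurable_l2.comp ?_) _) measurable_const) 2
  refine measurable_pi_lambda _ fun t => ?_
  simp only [Matrix.mul_apply, transpose_apply, of_apply]
  fun_prop

/-- Conditioning on the design: by independence the joint law is a product, and Fubini reduces to a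
fixed `x`. The column condition is part of the event so that slices with a bad design are empty. -/
theorem measure_excess_le (h : GaussianModel P X E Sig σ)
    {v r L : ℝ} (hv : 0 < v) (hL : 0 < L) (hT : 0 < T)
    (hr : 0 < r) (hrp : p * Real.exp (-L) ≤ r) :
    P {ω | (∀ j, σ ^ 2 * ∑ i, X ω i j ^ 2 ≤ v) ∧ r * (√(v * T) * (1 + √(2 * L / T))) ^ 2
        < excess (√(v * T) * (1 + √(2 * L / T))) (X ω) (E ω)} ≤ ENNReal.ofReal (1 / L) := by
  set τ := √(v * T) * (1 + √(2 * L / T)) with hτ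
  set A : Set ((Fin n → Fin p → ℝ) × (Fin n → Fin T → ℝ)) :=
    {q | (∀ j, σ ^ 2 * ∑ i, q.1 i j ^ 2 ≤ v) ∧
      r * τ ^ 2 < excess τ (Matrix.of q.1) (Matrix.of q.2)} with hA
  have hAm : MeasurableSet A := by
    have : {q : (Fin n → Fin p → ℝ) × (Fin n → Fin T → ℝ) |
        ∀ j, σ ^ 2 * ∑ i, q.1 i j ^ 2 ≤ v} = ⋂ j, {q | σ ^ 2 * ∑ i, q.1 i j ^ 2 ≤ v} := by
      ext; simp
    refine MeasurableSet.inter (s₁ := {q | ∀ j, σ ^ 2 * ∑ i, q.1 i j ^ 2 ≤ v}) ?_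
      (measurableSet_lt measurable_const (measurable_excess τ))
    rw [this]
    exact MeasurableSet.iInter fun j => measurableSet_le (by fun_prop) measurable_const
  have hmX := h.aemeasurable_design
  have hmE := h.aemeasurable_noise
  have hmap := (indepFun_iff_map_prod_eq_prod_map_map hmX hmE).1 h.indep
  have h1 : P {ω | (∀ j, σ ^ 2 * ∑ i, X ω i j ^ 2 ≤ v) ∧
      r * τ ^ 2 < excess τ (X ω) (E ω)}
      = P.map (fun ω => ((fun (i : Fin n) (j : Fin p) => X ω i j),
          (fun (i : Fin n) (t : Fin T) => E ω i t))) A := by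
    rw [Measure.map_apply_of_aemeasurable (hmX.prodMk hmE) hAm]
    rfl
  have hpX : IsProbabilityMeasure (P.map fun ω (i : Fin n) (j : Fin p) => X ω i j) :=
    Measure.isProbabilityMeasure_map hmX
  have hpE : IsProbabilityMeasure (P.map fun ω (i : Fin n) (t : Fin T) => E ω i t) :=
    Measure.isProbabilityMeasure_map hmE
  rw [h1, hmap, Measure.prod_apply hAm]
  refine (lintegral_mono (g := fun _ => ENNReal.ofReal (1 / L)) fun x => ?_).trans (by simp)
  have hxm : MeasurableSet (Prod.mk x ⁻¹' A) := measurable_prodMk_left hAm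
  simp only
  rw [Measure.map_apply_of_aemeasurable hmE hxm]
  by_cases hx : ∀ j, σ ^ 2 * ∑ i, x i j ^ 2 ≤ v
  · refine (measure_mono fun ω hω => ?_).trans
      (h.measure_excess_fixed_le (Matrix.of x) hv hx hL hT hr hrp)
    exact hω.2
  · refine (measure_mono (t := ∅) fun ω hω => ?_).trans (by simp)
    exact hx hω.1

end GaussianModel

/-! ### Sparse integer vectors and the transfer principle -/

section Transfer

variable {ι : Type*} [DecidableEq ι]

/-- The signed basis vector `± e_j`. -/
def signedBasis (q : ι × Bool) : ι → ℝ := Pi.single q.1 (if q.2 then 1 else -1)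

/-- The sum of the signed basis vectors listed in `m`. -/
def signedSum (m : Multiset (ι × Bool)) : ι → ℝ := (m.map signedBasis).sum

theorem signedSum_cons (q : ι × Bool) (m : Multiset (ι × Bool)) :
    signedSum (q ::ₘ m) = signedBasis q + signedSum m := by
  simp [signedSum]

theorem signedSum_replicate (k : ℕ) (q : ι × Bool) :
    signedSum (Multiset.replicate k q) = (k : ℝ) • signedBasis q := by
  rw [signedSum, Multiset.map_replicate, Multiset.sum_replicate, Nat.cast_smul_eq_nsmul]

variable [Fintype ι]

omit [DecidableEq ι] [Fintype ι] in
-- The `w`-average over `j` of the left side is at most the right side, because the cross terms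
-- average to those of `x`; some `j` does no worse than the average. The form may be indefinite.
theorem exists_quadForm_add_le (B : (ι → ℝ) →ₗ[ℝ] (ι → ℝ) →ₗ[ℝ] ℝ) {κ : Type*} [Fintype κ]
    (b : κ → ι → ℝ) (w : κ → ℝ) (hw : ∀ j, 0 ≤ w j) (hw1 : ∑ j, w j = 1) {C : ℝ}
    (hC : ∀ j, B (b j) (b j) ≤ C) (x y : ι → ℝ) (hx : ∑ j, w j • b j = x) :
    ∃ j, B (y + b j) (y + b j) ≤ B (y + x) (y + x) + (C - B x x) := by
  by_contra! hcon
  have h1 : ∑ j, w j * (B (y + x) (y + x) + (C - B x x)) < ∑ j, w j * B (y + b j) (y + b j) := by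
    obtain ⟨j, hj⟩ : ∃ j, 0 < w j := by
      by_contra! hj
      have : ∑ j, w j ≤ 0 := Finset.sum_nonpos fun j _ => hj j
      linarith
    exact Finset.sum_lt_sum (fun i _ => mul_le_mul_of_nonneg_left (hcon i).le (hw i))
      ⟨j, Finset.mem_univ j, mul_lt_mul_of_pos_left (hcon j) hj⟩
  have h2 : ∑ j, w j * B (y + b j) (y + b j)
      = B y y + B y x + B x y + ∑ j, w j * B (b j) (b j) := by
    have e1 : B y x = ∑ j, w j * B y (b j) := by rw [← hx]; simp
    have e2 : B x y = ∑ j, w j * B (b j) y := by rw [← hx]; simp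
    have e3 : B y y = ∑ j, w j * B y y := by rw [← Finset.sum_mul, hw1, one_mul]
    rw [e1, e2, e3, ← Finset.sum_add_distrib, ← Finset.sum_add_distrib, ← Finset.sum_add_distrib]
    refine Finset.sum_congr rfl fun j _ => ?_
    simp only [map_add, LinearMap.add_apply]
    ring
  have h3 : ∑ j, w j * B (b j) (b j) ≤ C := by
    calc ∑ j, w j * B (b j) (b j) ≤ ∑ j, w j * C :=
          Finset.sum_le_sum fun j _ => mul_le_mul_of_nonneg_left (hC j) (hw j)
      _ = C := by rw [← Finset.sum_mul, hw1, one_mul]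
  rw [← Finset.sum_mul, hw1, h2] at h1
  simp only [map_add, LinearMap.add_apply] at h1
  linarith

/-- If a quadratic form is nonnegative at all sums of `k` signed basis vectors, then it is
bounded below by a multiple of the squared `ℓ¹` norm. -/
theorem quadForm_transfer (B : (ι → ℝ) →ₗ[ℝ] (ι → ℝ) →ₗ[ℝ] ℝ) {k : ℕ} (hk : 0 < k) {C : ℝ}
    (hC : ∀ q : ι × Bool, B (signedBasis q) (signedBasis q) ≤ C)
    (hB : ∀ m : Multiset (ι × Bool), m.card = k → 0 ≤ B (signedSum m) (signedSum m))
    (u : ι → ℝ) : -(C * (∑ j, |u j|) ^ 2) ≤ ((k : ℝ) - 1) * B u u := by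
  rcases (Finset.sum_nonneg fun j _ => abs_nonneg (u j) : 0 ≤ ∑ j, |u j|).eq_or_lt with h0 | hN
  · have hu : u = 0 := by
      funext j
      have := (Finset.sum_eq_zero_iff_of_nonneg fun j _ => abs_nonneg (u j)).1 h0.symm j
        (Finset.mem_univ j)
      simpa using this
    simp [hu]
  -- Maurey's device: `x = u / N` is a convex combination of signed basis vectors, with weights `|u
  -- j| / N`.
  set N := ∑ j, |u j| with hNdef
  set b : ι → ι → ℝ := fun j => signedBasis (j, decide (0 ≤ u j)) with hb
  set x : ι → ℝ := N⁻¹ • u with hx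
  have hw1 : ∑ j, |u j| / N = 1 := by rw [← Finset.sum_div, div_self hN.ne']
  have hxb : ∑ j, (|u j| / N) • b j = x := by
    funext i
    rw [Finset.sum_apply, Finset.sum_eq_single i]
    · rcases le_or_gt 0 (u i) with h | h
      · simp [hb, signedBasis, hx, h, abs_of_nonneg h]
        field_simp
      · simp [hb, signedBasis, hx, not_le.2 h, abs_of_neg h]
        field_simp
    · intro j _ hji
      simp [hb, signedBasis, Pi.single_eq_of_ne hji.symm]
    · simp
  -- The `k` copies of `x` are replaced one at a time by signed basis vectors, each replacement
  -- costing at most `C - B x x`. The free offset `y` absorbs the vectors already chosen.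
  have key : ∀ (k : ℕ) (y : ι → ℝ), ∃ m : Multiset (ι × Bool), m.card = k ∧
      B (signedSum m + y) (signedSum m + y)
        ≤ B (y + (k : ℝ) • x) (y + (k : ℝ) • x) + k * (C - B x x) := by
    intro k
    induction k with
    | zero => exact fun y => ⟨0, by simp, by simp [signedSum]⟩
    | succ k ih =>
      intro y
      obtain ⟨j, hj⟩ := exists_quadForm_add_le B b (fun j => |u j| / N) (fun j => by positivity)
        hw1 (fun j => hC _) x (y + (k : ℝ) • x) hxb
      obtain ⟨m, hm, hmB⟩ := ih (y + b j)
      refine ⟨(j, decide (0 ≤ u j)) ::ₘ m, by simp [hm], ?_⟩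
      rw [signedSum_cons]
      have e1 : signedBasis (j, decide (0 ≤ u j)) + signedSum m + y = signedSum m + (y + b j) := by
        simp only [hb]; abel
      have e2 : y + b j + (k : ℝ) • x = y + (k : ℝ) • x + b j := by abel
      have e3 : y + ((k + 1 : ℕ) : ℝ) • x = y + (k : ℝ) • x + x := by
        push_cast; rw [add_smul, one_smul]; abel
      rw [e2] at hmB
      rw [e1, e3]
      push_cast
      linarith
  obtain ⟨m, hm, hmB⟩ := key k 0
  have h0 := hB m hm
  rw [add_zero, zero_add] at hmB
  have hux : u = N • x := by rw [hx, smul_smul, mul_inv_cancel₀ hN.ne', one_smul]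
  have hBu : B u u = N ^ 2 * B x x := by rw [hux]; simp; ring
  simp only [map_smul, LinearMap.smul_apply, smul_eq_mul] at hmB
  have hk' : (0 : ℝ) < k := by exact_mod_cast hk
  -- At `y = 0` the bound reads `k² B x x + k (C - B x x)`; the diagonal correction turns the factor
  -- `k` into `k - 1`.
  have h1 : 0 ≤ (k : ℝ) * (((k : ℝ) - 1) * B x x + C) := by nlinarith
  have h2 : 0 ≤ ((k : ℝ) - 1) * B x x + C := nonneg_of_mul_nonneg_right h1 hk'
  rw [hBu]
  nlinarith [mul_nonneg (sq_nonneg N) h2]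

/-- The symmetric bilinear form of `v ↦ α * ‖x v‖² + β * ‖v‖²`. -/
noncomputable def gramForm {n : ℕ} (x : Matrix (Fin n) ι ℝ) (α β : ℝ) :
    (ι → ℝ) →ₗ[ℝ] (ι → ℝ) →ₗ[ℝ] ℝ :=
  Matrix.toLinearMap₂' ℝ (α • (xᵀ * x) + β • (1 : Matrix ι ι ℝ))

theorem gramForm_self {n : ℕ} (x : Matrix (Fin n) ι ℝ) (α β : ℝ) (v : ι → ℝ) :
    gramForm x α β v v = α * l2 (x *ᵥ v) ^ 2 + β * l2 v ^ 2 := by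
  rw [gramForm, Matrix.toLinearMap₂'_apply', add_mulVec, smul_mulVec, smul_mulVec, one_mulVec,
    dotProduct_add, dotProduct_smul, dotProduct_smul, dotProduct_self_eq_l2_sq,
    ← mulVec_mulVec, dotProduct_mulVec, vecMul_transpose, dotProduct_self_eq_l2_sq]
  simp

theorem l2_signedBasis_sq (q : ι × Bool) : l2 (signedBasis q) ^ 2 = 1 := by
  rw [l2_sq, Finset.sum_eq_single q.1]
  · simp [signedBasis]
  · intro j _ hj
    simp [signedBasis, Pi.single_eq_of_ne hj]
  · simp

omit [DecidableEq ι] in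
theorem l2_smul_sq (c : ℝ) (v : ι → ℝ) : l2 (c • v) ^ 2 = c ^ 2 * l2 v ^ 2 := by
  simp [l2_sq, mul_pow, Finset.mul_sum]

/-- The matrix `x` acts on sums of `k` signed basis vectors as an isometry up to the
factors `A₁` and `A₂`. -/
def IsSparseIsometry {n : ℕ} (x : Matrix (Fin n) ι ℝ) (k : ℕ) (A₁ A₂ : ℝ) : Prop :=
  ∀ m : Multiset (ι × Bool), m.card = k →
    A₁ * l2 (signedSum m) ^ 2 ≤ l2 (x *ᵥ signedSum m) ^ 2 ∧
      l2 (x *ᵥ signedSum m) ^ 2 ≤ A₂ * l2 (signedSum m) ^ 2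

namespace IsSparseIsometry

variable {n k : ℕ} {x : Matrix (Fin n) ι ℝ} {A₁ A₂ : ℝ}

/-- Multisets allow repetition: `k` copies of one signed basis vector are among the test vectors,
which gives the constant `C` of `quadForm_transfer`. -/
theorem signedBasis_le (h : IsSparseIsometry x k A₁ A₂) (hk : 0 < k) (q : ι × Bool) :
    l2 (x *ᵥ signedBasis q) ^ 2 ≤ A₂ := by
  have := (h (Multiset.replicate k q) (by simp)).2
  rw [signedSum_replicate, mulVec_smul, l2_smul_sq, l2_smul_sq, l2_signedBasis_sq] at this
  have hk' : (0 : ℝ) < (k : ℝ) ^ 2 := by positivity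
  nlinarith

theorem lower (h : IsSparseIsometry x k A₁ A₂) (hk : 0 < k) (hA : 0 ≤ A₁) (u : ι → ℝ) :
    ((k : ℝ) - 1) * (A₁ * l2 u ^ 2) - A₂ * (∑ j, |u j|) ^ 2
      ≤ ((k : ℝ) - 1) * l2 (x *ᵥ u) ^ 2 := by
  have := quadForm_transfer (gramForm x 1 (-A₁)) hk (C := A₂) (fun q => by
    rw [gramForm_self, l2_signedBasis_sq]
    linarith [h.signedBasis_le hk q]) (fun m hm => by
    rw [gramForm_self]
    linarith [(h m hm).1]) u
  rw [gramForm_self] at this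
  linarith

theorem upper (h : IsSparseIsometry x k A₁ A₂) (hk : 0 < k) (u : ι → ℝ) :
    ((k : ℝ) - 1) * l2 (x *ᵥ u) ^ 2
      ≤ ((k : ℝ) - 1) * (A₂ * l2 u ^ 2) + A₂ * (∑ j, |u j|) ^ 2 := by
  have := quadForm_transfer (gramForm x (-1) A₂) hk (C := A₂) (fun q => by
    rw [gramForm_self, l2_signedBasis_sq]
    nlinarith [sq_nonneg (l2 (x *ᵥ signedBasis q))]) (fun m hm => by
    rw [gramForm_self]
    linarith [(h m hm).2]) u
  rw [gramForm_self] at this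
  linarith

end IsSparseIsometry

end Transfer

/-! ### Frobenius and mixed norms -/

section Frobenius

theorem frobSq_eq_sum_rows {ι κ : Type*} [Fintype ι] [Fintype κ] (M : Matrix ι κ ℝ) :
    frobSq M = ∑ i, l2 (M i) ^ 2 := by
  simp [frobSq, l2_sq]

theorem frobSq_eq_sum_cols {ι κ : Type*} [Fintype ι] [Fintype κ] (M : Matrix ι κ ℝ) :
    frobSq M = ∑ k, l2 (fun i => M i k) ^ 2 := by
  simp only [frobSq, l2_sq]
  exact Finset.sum_comm

theorem frobSq_nonneg {ι κ : Type*} [Fintype ι] [Fintype κ] (M : Matrix ι κ ℝ) : 0 ≤ frobSq M :=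
  Finset.sum_nonneg fun _ _ => Finset.sum_nonneg fun _ _ => sq_nonneg _

theorem l2_add_le {ι : Type*} [Fintype ι] (u v : ι → ℝ) : l2 (u + v) ≤ l2 u + l2 v := by
  simpa [l2] using norm_add_le (WithLp.toLp 2 u) (WithLp.toLp 2 v)

theorem l2_sum_le {ι κ : Type*} [Fintype ι] (s : Finset κ) (f : κ → ι → ℝ) :
    l2 (∑ k ∈ s, f k) ≤ ∑ k ∈ s, l2 (f k) := by
  simpa [l2, WithLp.toLp_sum] using norm_sum_le s fun k => WithLp.toLp 2 (f k)

/-- Minkowski's inequality for the mixed norms of a matrix. -/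
theorem sum_sq_sum_abs_le {ι κ : Type*} [Fintype ι] [Fintype κ] (W : Matrix ι κ ℝ) :
    ∑ t, (∑ j, |W j t|) ^ 2 ≤ (∑ j, l2 (W j)) ^ 2 := by
  have h1 : ∑ t, (∑ j, |W j t|) ^ 2 = l2 (∑ j, fun t => |W j t|) ^ 2 := by
    rw [l2_sq]
    simp
  have h2 : ∀ j, l2 (fun t => |W j t|) = l2 (W j) := fun j => by simp [l2_eq_sqrt]
  rw [h1]
  refine pow_le_pow_left₀ (l2_nonneg _) ((l2_sum_le _ _).trans_eq ?_) 2
  simp only [h2]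

namespace IsSparseIsometry

variable {ι : Type*} [DecidableEq ι] [Fintype ι] {n k T : ℕ} {x : Matrix (Fin n) ι ℝ} {A₁ A₂ : ℝ}

/-- The vector bound is summed over tasks, and Minkowski's inequality collects the squared `ℓ¹`
norms of the columns into the squared sum of row norms. Hence the isometry event concerns vectors in
`ℝᵖ` only, without any factor `T`. -/
theorem frobSq_lower (h : IsSparseIsometry x k A₁ A₂) (hk : 0 < k) (hA : 0 ≤ A₁)
    (hA₂ : 0 ≤ A₂) (W : Matrix ι (Fin T) ℝ) :
    ((k : ℝ) - 1) * (A₁ * frobSq W) - A₂ * (∑ j, l2 (W j)) ^ 2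
      ≤ ((k : ℝ) - 1) * frobSq (x * W) := by
  have h1 := Finset.sum_le_sum fun t (_ : t ∈ Finset.univ) => h.lower hk hA fun j => W j t
  rw [Finset.sum_sub_distrib, ← Finset.mul_sum, ← Finset.mul_sum, ← Finset.mul_sum,
    ← Finset.mul_sum, ← frobSq_eq_sum_cols] at h1
  have h2 := mul_le_mul_of_nonneg_left (sum_sq_sum_abs_le W) hA₂
  rw [frobSq_eq_sum_cols (x * W)]
  exact le_trans (by linarith) h1

theorem frobSq_upper (h : IsSparseIsometry x k A₁ A₂) (hk : 0 < k) (hA₂ : 0 ≤ A₂)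
    (W : Matrix ι (Fin T) ℝ) :
    ((k : ℝ) - 1) * frobSq (x * W)
      ≤ ((k : ℝ) - 1) * (A₂ * frobSq W) + A₂ * (∑ j, l2 (W j)) ^ 2 := by
  have h1 := Finset.sum_le_sum fun t (_ : t ∈ Finset.univ) => h.upper hk fun j => W j t
  rw [Finset.sum_add_distrib, ← Finset.mul_sum, ← Finset.mul_sum, ← Finset.mul_sum,
    ← Finset.mul_sum, ← frobSq_eq_sum_cols] at h1
  have h2 := mul_le_mul_of_nonneg_left (sum_sq_sum_abs_le W) hA₂
  rw [frobSq_eq_sum_cols (x * W)]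
  exact le_trans h1 (by linarith)

end IsSparseIsometry

end Frobenius

/-! ### Probability of the sparse isometry property -/

/-- The count is `choose (2p + k - 1) k ≤ (3p)^k / k!`; then `k^k / k! ≤ e^k` and `3 ≤ e²` give the
constant `3`. -/
theorem card_sym_signed_le {p k : ℕ} (hk : 0 < k) (hkp : k ≤ p) :
    (Fintype.card (Sym (Fin p × Bool) k) : ℝ) ≤ Real.exp (k * (3 + Real.log (p / k))) := by
  have hk' : (0 : ℝ) < k := by exact_mod_cast hk
  have hp' : (0 : ℝ) < p := by exact_mod_cast hk.trans_le hkp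
  have h1 : (Fintype.card (Sym (Fin p × Bool) k) : ℝ) ≤ (3 * p : ℝ) ^ k / k.factorial := by
    rw [Sym.card_sym_eq_choose]
    refine (Nat.choose_le_pow_div k _).trans ?_
    have h2 : ((Fintype.card (Fin p × Bool) + k - 1 : ℕ) : ℝ) ≤ 3 * p := by
      simp only [Fintype.card_prod, Fintype.card_fin, Fintype.card_bool]
      exact_mod_cast (by omega : p * 2 + k - 1 ≤ 3 * p)
    gcongr
  have h3 := Real.pow_div_factorial_le_exp (k : ℝ) hk'.le k
  have h4 : (3 * p : ℝ) ^ k / k.factorial = (3 * (p / k) : ℝ) ^ k * ((k : ℝ) ^ k / k.factorial) := by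
    rw [mul_div_assoc', ← mul_pow]
    congr 2
    field_simp
  have h5 : (3 * (p / k) : ℝ) ≤ Real.exp (2 + Real.log (p / k)) := by
    rw [Real.exp_add, Real.exp_log (by positivity)]
    have : (3 : ℝ) ≤ Real.exp 2 := by linarith [Real.add_one_le_exp (2 : ℝ)]
    gcongr
  calc _ ≤ _ := h1
    _ = _ := h4
    _ ≤ Real.exp (2 + Real.log (p / k)) ^ k * Real.exp k := by gcongr
    _ = _ := by
      rw [← Real.exp_nat_mul, ← Real.exp_add]
      congr 1
      ring

namespace GaussianModel

variable {Ω : Type*} [MeasurableSpace Ω] {P : Measure Ω} {n p T : ℕ}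
  {X : Ω → Matrix (Fin n) (Fin p) ℝ} {E : Ω → Matrix (Fin n) (Fin T) ℝ}
  {Sig : Matrix (Fin p) (Fin p) ℝ} {σ : ℝ}

/-- Chi-square deviations at the levels `a = 2` and `a = 1/2`, whence the factors `4` and `1/4`; the
lower tail, with exponent `n/8`, is the weaker one. -/
theorem measure_mulVec_deviation_le (h : GaussianModel P X E Sig σ) (hS : Sig.IsHermitian)
    {c d : ℝ} (hc : 0 < c) (hspec : spectrum ℝ Sig ⊆ Set.Icc c d) (z : Fin p → ℝ) :
    P {ω | ¬(c * n / 4 * l2 z ^ 2 ≤ l2 (X ω *ᵥ z) ^ 2 ∧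
        l2 (X ω *ᵥ z) ^ 2 ≤ d * n * 4 * l2 z ^ 2)}
      ≤ ENNReal.ofReal (2 * Real.exp (-(n / 8))) := by
  have hlo := le_quadForm_of_spectrum hS hspec z
  have hup := quadForm_le_of_spectrum hS hspec z
  rcases (sq_nonneg (l2 z)).eq_or_lt with h0 | h0
  · have hz : z = 0 := by
      have h1 : l2 z = 0 := by simpa using h0.symm
      rw [l2, norm_eq_zero] at h1
      simpa using h1
    refine (measure_mono (t := ∅) fun ω hω => ?_).trans (by simp)
    refine hω ?_
    subst hz
    simp [l2]
  have hq : 0 < z ⬝ᵥ (Sig *ᵥ z) := lt_of_lt_of_le (by positivity) hlo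
  have hF := h.design_mulVec (posSemidef_of_spectrum hS hspec hc.le) z
  have h1 := hF.measure_upper_le (a := 2) (by norm_num) hq
  have h2 := hF.measure_lower_le (a := 1 / 2) (by norm_num) (by norm_num) hq
  rw [Fintype.card_fin] at h1 h2
  refine (measure_mono (fun ω hω => ?_)).trans ((measure_union_le _ _).trans
    ((add_le_add h2 h1).trans ?_))
  · simp only [Set.mem_ofPred_eq, not_and_or, not_le] at hω
    rw [l2_sq (X ω *ᵥ z)] at hω
    have hn : (0 : ℝ) ≤ n := Nat.cast_nonneg n
    rcases hω with hω | hω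
    · refine Or.inl ?_
      simp only [Set.mem_ofPred_eq]
      refine hω.trans_le ?_
      nlinarith [mul_le_mul_of_nonneg_left hlo hn]
    · refine Or.inr ?_
      simp only [Set.mem_ofPred_eq]
      refine lt_of_le_of_lt ?_ hω
      nlinarith [mul_le_mul_of_nonneg_left hup hn]
  · rw [← ENNReal.ofReal_add (by positivity) (by positivity)]
    refine ENNReal.ofReal_le_ofReal ?_
    have hn : (0 : ℝ) ≤ n := Nat.cast_nonneg n
    have e1 : Real.exp (-(n * (1 / 2 - 1) ^ 2 / 2)) ≤ Real.exp (-(n / 8) : ℝ) :=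
      Real.exp_le_exp.2 (by linarith)
    have e2 : Real.exp (-(n * (2 - 1) ^ 2 / 2)) ≤ Real.exp (-(n / 8) : ℝ) :=
      Real.exp_le_exp.2 (by linarith)
    linarith

theorem measure_not_isSparseIsometry_le (h : GaussianModel P X E Sig σ) (hS : Sig.IsHermitian)
    {c d : ℝ} (hc : 0 < c) (hspec : spectrum ℝ Sig ⊆ Set.Icc c d) {k : ℕ} (hk : 0 < k)
    (hkp : k ≤ p) :
    P {ω | ¬IsSparseIsometry (X ω) k (c * n / 4) (d * n * 4)}
      ≤ ENNReal.ofReal (2 * Real.exp (k * (3 + Real.log (p / k)) - n / 8)) := by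
  have hsub : {ω | ¬IsSparseIsometry (X ω) k (c * n / 4) (d * n * 4)} ⊆
      ⋃ m : Sym (Fin p × Bool) k, {ω | ¬(c * n / 4 * l2 (signedSum m.1) ^ 2
        ≤ l2 (X ω *ᵥ signedSum m.1) ^ 2 ∧
        l2 (X ω *ᵥ signedSum m.1) ^ 2
          ≤ d * n * 4 * l2 (signedSum m.1) ^ 2)} := by
    intro ω hω
    simp only [IsSparseIsometry, Set.mem_ofPred_eq, not_forall] at hω
    obtain ⟨m, hm, hω⟩ := hω
    exact Set.mem_iUnion.2 ⟨⟨m, hm⟩, hω⟩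
  refine (measure_mono hsub).trans ((measure_iUnion_fintype_le _ _).trans ?_)
  refine (Finset.sum_le_sum fun m _ =>
    h.measure_mulVec_deviation_le hS hc hspec (signedSum m.1)).trans ?_
  rw [Finset.sum_const, Finset.card_univ, ← ENNReal.ofReal_nsmul, nsmul_eq_mul]
  refine ENNReal.ofReal_le_ofReal ?_
  rw [sub_eq_add_neg, Real.exp_add]
  have := mul_le_mul_of_nonneg_right (card_sym_signed_le hk hkp)
    (by positivity : 0 ≤ 2 * Real.exp (-(n / 8 : ℝ)))
  linarith

theorem measure_column_norm_le (h : GaussianModel P X E Sig σ) (hS : Sig.PosSemidef)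
    (hpos : ∀ j, 0 < Sig j j) {η : ℝ} (hη : 0 < η) :
    P {ω | ∃ j, Sig j j * n * (1 + η) ^ 2 < ∑ i, X ω i j ^ 2}
      ≤ ENNReal.ofReal (p * Real.exp (-(n * η ^ 2 / 2))) := by
  have hsub : {ω | ∃ j, Sig j j * n * (1 + η) ^ 2 < ∑ i, X ω i j ^ 2} ⊆
      ⋃ j, {ω | Sig j j * n * (1 + η) ^ 2 < ∑ i, X ω i j ^ 2} := by
    intro ω hω
    obtain ⟨j, hj⟩ := hω
    exact Set.mem_iUnion.2 ⟨j, hj⟩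
  refine (measure_mono hsub).trans ((measure_iUnion_fintype_le _ _).trans ?_)
  have h1 : ∀ j, P {ω | Sig j j * n * (1 + η) ^ 2 < ∑ i, X ω i j ^ 2}
      ≤ ENNReal.ofReal (Real.exp (-(n * η ^ 2 / 2))) := by
    intro j
    have hF := h.design_mulVec hS (Pi.single j 1)
    have e1 : (Pi.single j 1 : Fin p → ℝ) ⬝ᵥ (Sig *ᵥ Pi.single j 1) = Sig j j := by
      simp
    have e2 : ∀ ω i, (X ω *ᵥ (Pi.single j 1 : Fin p → ℝ)) i = X ω i j := by
      intro ω i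
      simp
    simp only [e1, e2] at hF
    have := hF.measure_upper_le (a := 1 + η) (by linarith) (hpos j)
    rwa [Fintype.card_fin, add_sub_cancel_left] at this
  refine (Finset.sum_le_sum fun j _ => h1 j).trans ?_
  rw [Finset.sum_const, Finset.card_univ, ← ENNReal.ofReal_nsmul, nsmul_eq_mul, Fintype.card_fin]

theorem measure_frobSq_noise_le (h : GaussianModel P X E Sig σ) (hσ : 0 < σ) :
    P {ω | σ ^ 2 * (n * T) * 4 < frobSq (E ω)}
      ≤ ENNReal.ofReal (Real.exp (-(n * T / 2))) := by
  have := h.noise_entries.measure_upper_le (a := 2) (by norm_num) (by positivity)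
  simp only [Fintype.sum_prod_type, Fintype.card_prod, Fintype.card_fin, Nat.cast_mul] at this
  norm_num at this
  exact this

theorem measure_noise_mulVec_deviation_le [IsProbabilityMeasure P] (h : GaussianModel P X E Sig σ)
    (hσ : 0 < σ) {b : Fin T → ℝ} (hb : l2 b = 1) {δ : ℝ} (hδ : 0 < δ) (hδ1 : δ < 1) :
    P {ω | ¬|l2 (E ω *ᵥ b) - σ * √n| ≤ σ * √n * δ}
      ≤ ENNReal.ofReal (2 * Real.exp (-(n * δ ^ 2 / 2))) := by
  have hF := h.noise_mulVec b
  rw [hb, one_pow, mul_one] at hF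
  have h1 := hF.measure_upper_le (a := 1 + δ) (by linarith) (by positivity)
  have h2 := hF.measure_lower_le (a := 1 - δ) (by linarith) (by linarith) (by positivity)
  rw [Fintype.card_fin] at h1 h2
  refine (measure_mono (fun ω hω => ?_)).trans ((measure_union_le _ _).trans
    ((add_le_add h2 h1).trans ?_))
  · simp only [Set.mem_ofPred_eq, abs_le, not_and_or, not_le] at hω
    have hs : ∀ a : ℝ, σ ^ 2 * n * a ^ 2 = (σ * √n * a) ^ 2 := by
      intro a
      rw [mul_pow, mul_pow, Real.sq_sqrt (Nat.cast_nonneg n)]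
    have h0 := l2_nonneg (E ω *ᵥ b)
    rcases hω with hω | hω
    · refine Or.inl ?_
      simp only [Set.mem_ofPred_eq]
      rw [hs, ← l2_sq]
      exact pow_lt_pow_left₀ (by linarith) h0 two_ne_zero
    · refine Or.inr ?_
      simp only [Set.mem_ofPred_eq]
      rw [hs, ← l2_sq]
      exact pow_lt_pow_left₀ (by linarith) (by positivity) two_ne_zero
  · rw [← ENNReal.ofReal_add (by positivity) (by positivity)]
    refine ENNReal.ofReal_le_ofReal (le_of_eq ?_)
    ring_nf

end GaussianModel

/-! ### The Frobenius inner product -/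

section Inner

variable {ι κ μ : Type*} [Fintype ι] [Fintype κ] [Fintype μ]

/-- The Frobenius inner product. -/
def frobInner (M N : Matrix ι κ ℝ) : ℝ := ∑ i, M i ⬝ᵥ N i

theorem frobInner_eq_trace (M N : Matrix ι κ ℝ) : frobInner M N = (M * Nᵀ).trace := by
  simp [frobInner, Matrix.trace, Matrix.mul_apply, dotProduct]

theorem frobInner_self (M : Matrix ι κ ℝ) : frobInner M M = frobSq M := by
  simp only [frobInner, dotProduct_self_eq_l2_sq, frobSq_eq_sum_rows]

theorem frobInner_sub_left (M M' N : Matrix ι κ ℝ) :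
    frobInner (M - M') N = frobInner M N - frobInner M' N := by
  simp [frobInner_eq_trace, Matrix.sub_mul]

theorem frobInner_neg_right (M N : Matrix ι κ ℝ) : frobInner M (-N) = -frobInner M N := by
  simp [frobInner_eq_trace]

theorem frobInner_mul_right (R : Matrix ι κ ℝ) (x : Matrix ι μ ℝ) (D : Matrix μ κ ℝ) :
    frobInner R (x * D) = frobInner (xᵀ * R) D := by
  rw [frobInner_eq_trace, frobInner_eq_trace, transpose_mul, ← Matrix.mul_assoc,
    Matrix.trace_mul_comm, ← Matrix.mul_assoc]

theorem frobInner_le (M N : Matrix ι κ ℝ) : frobInner M N ≤ √(frobSq M) * √(frobSq N) := by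
  have := Real.sum_mul_le_sqrt_mul_sqrt Finset.univ (fun i => l2 (M i)) (fun i => l2 (N i))
  rw [← frobSq_eq_sum_rows, ← frobSq_eq_sum_rows] at this
  exact (Finset.sum_le_sum fun i _ => dotProduct_le_l2_mul (M i) (N i)).trans this

theorem frobSq_sub_smul (R V : Matrix ι κ ℝ) (t : ℝ) :
    frobSq (R - t • V) = frobSq R - 2 * t * frobInner R V + t ^ 2 * frobSq V := by
  simp only [frobSq, frobInner, dotProduct, Finset.mul_sum, ← Finset.sum_add_distrib,
    ← Finset.sum_sub_distrib]
  refine Finset.sum_congr rfl fun i _ => Finset.sum_congr rfl fun j _ => ?_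
  simp only [Matrix.sub_apply, Matrix.smul_apply, smul_eq_mul]
  ring

end Inner

theorem l2_smul_of_nonneg {ι : Type*} [Fintype ι] {c : ℝ} (hc : 0 ≤ c) (v : ι → ℝ) :
    l2 (c • v) = c * l2 v := by
  simp [l2, norm_smul, abs_of_nonneg hc]

theorem l2_neg {ι : Type*} [Fintype ι] (v : ι → ℝ) : l2 (-v) = l2 v := by
  simp [l2]

theorem l2_zero {ι : Type*} [Fintype ι] : l2 (0 : ι → ℝ) = 0 := by
  simp [l2]

theorem l2_pos {ι : Type*} [Fintype ι] {v : ι → ℝ} (hv : v ≠ 0) : 0 < l2 v := by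
  rw [l2, norm_pos_iff]
  simpa using hv

/-! ### Optimality conditions -/

section Optimality

variable {n p T : ℕ} {x : Matrix (Fin n) (Fin p) ℝ} {y : Matrix (Fin n) (Fin T) ℝ} {lam : ℝ}
  {B : Matrix (Fin p) (Fin T) ℝ}

/-- First-order optimality without subgradients: compare `B` with `B + t (B' - B)`, bound the
penalty by convexity, divide by `t` and let `t → 0`. It is used with `B'` the true matrix, and with
`B'` equal to `B` with one row erased. -/
theorem IsMultiTaskLasso.variational (h : IsMultiTaskLasso x y lam B) (hlam : 0 ≤ lam)
    (hn : 0 < n) (hT : 0 < T) (B' : Matrix (Fin p) (Fin T) ℝ) :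
    frobInner (y - x * B) (x * (B' - B))
      ≤ n * T * lam * (∑ j, l2 (B' j) - ∑ j, l2 (B j)) := by
  have hN : (0 : ℝ) < n * T := by positivity
  set R := y - x * B with hR
  set V := x * (B' - B) with hV
  have key : ∀ t : ℝ, 0 < t → t ≤ 1 →
      frobInner R V ≤ n * T * lam * (∑ j, l2 (B' j) - ∑ j, l2 (B j)) + t * (frobSq V / 2) := by
    intro t ht ht1
    have h1 := h (B + t • (B' - B))
    simp only [objective] at h1
    have e1 : y - x * (B + t • (B' - B)) = R - t • V := by
      rw [hR, hV, Matrix.mul_add, Matrix.mul_smul]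
      abel
    rw [e1, frobSq_sub_smul] at h1
    have e2 : ∑ j, l2 ((B + t • (B' - B)) j) ≤ (1 - t) * ∑ j, l2 (B j) + t * ∑ j, l2 (B' j) := by
      rw [Finset.mul_sum, Finset.mul_sum, ← Finset.sum_add_distrib]
      refine Finset.sum_le_sum fun j _ => ?_
      have : (B + t • (B' - B)) j = (1 - t) • B j + t • B' j := by
        funext i
        simp only [Matrix.add_apply, Matrix.smul_apply, Matrix.sub_apply, Pi.add_apply,
          Pi.smul_apply, smul_eq_mul]
        ring
      rw [this]
      refine (l2_add_le _ _).trans ?_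
      rw [l2_smul_of_nonneg (by linarith), l2_smul_of_nonneg ht.le]
    have h2 := mul_le_mul_of_nonneg_left e2 hlam
    have h3 : 0 ≤ t * (-(frobInner R V) + t * (frobSq V / 2)
        + n * T * lam * (∑ j, l2 (B' j) - ∑ j, l2 (B j))) := by
      have h4 : 0 ≤ 1 / (2 * (n : ℝ) * T) * (-(2 * t * frobInner R V) + t ^ 2 * frobSq V)
          + lam * t * (∑ j, l2 (B' j) - ∑ j, l2 (B j)) := by nlinarith
      have h5 := mul_nonneg hN.le h4
      have h6 : (n * T : ℝ) * (1 / (2 * (n : ℝ) * T) * (-(2 * t * frobInner R V) + t ^ 2 * frobSq V)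
          + lam * t * (∑ j, l2 (B' j) - ∑ j, l2 (B j)))
          = t * (-(frobInner R V) + t * (frobSq V / 2)
        + n * T * lam * (∑ j, l2 (B' j) - ∑ j, l2 (B j))) := by
        field_simp
      rwa [h6] at h5
    have := nonneg_of_mul_nonneg_right h3 ht
    linarith
  refine le_of_forall_pos_le_add fun ε hε => ?_
  have hV0 := frobSq_nonneg V
  -- Small enough that the quadratic remainder is at most `ε`; the `+ 1` covers `V = 0`.
  set t := min 1 (ε / (frobSq V / 2 + 1)) with ht
  have ht0 : 0 < t := lt_min one_pos (by positivity)
  refine (key t ht0 (min_le_left _ _)).trans ?_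
  have : t * (frobSq V / 2) ≤ ε := by
    calc t * (frobSq V / 2) ≤ ε / (frobSq V / 2 + 1) * (frobSq V / 2 + 1) := by
          gcongr
          · exact min_le_right _ _
          · linarith
      _ = ε := by field_simp
  linarith

theorem mem_rowSupport {j : Fin p} : j ∈ rowSupport B ↔ B j ≠ 0 := by
  simp [rowSupport]

/-- Erasing row `j` gives `n T λ ‖B_j‖ ≤ ⟨(xᵀ R)_j, B_j⟩` with `R` the residual; Cauchy-Schwarz and
division by `‖B_j‖` finish. This half of the stationarity condition is all that the sparsity bound
needs. -/
theorem IsMultiTaskLasso.le_l2_of_mem_rowSupport (h : IsMultiTaskLasso x y lam B) (hlam : 0 ≤ lam)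
    (hn : 0 < n) (hT : 0 < T) {j : Fin p} (hj : j ∈ rowSupport B) :
    n * T * lam ≤ l2 ((xᵀ * (y - x * B)) j) := by
  have hB := l2_pos (mem_rowSupport.1 hj)
  have h1 := h.variational hlam hn hT (B.updateRow j 0)
  rw [frobInner_mul_right, frobInner, Finset.sum_eq_single j] at h1
  · rw [← Finset.sum_sub_distrib, Finset.sum_eq_single j] at h1
    · have e1 : (B.updateRow j 0 - B) j = -B j := by
        funext t
        simp [Matrix.sub_apply]
      rw [e1] at h1
      simp only [updateRow_self, l2_zero, zero_sub, dotProduct_neg, mul_neg, neg_le_neg_iff] at h1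
      exact le_of_mul_le_mul_right (h1.trans (dotProduct_le_l2_mul _ _)) hB
    · intro i _ hij
      simp [updateRow_ne hij]
    · simp
  · intro i _ hij
    have e1 : (B.updateRow j 0 - B) i = 0 := by
      funext t
      simp [Matrix.sub_apply, updateRow_ne hij]
    rw [e1, dotProduct_zero]
  · simp

end Optimality

/-! ### Deterministic bounds for the estimate -/

section Bounds

variable {n p T : ℕ} {x : Matrix (Fin n) (Fin p) ℝ} {e : Matrix (Fin n) (Fin T) ℝ}
  {B Bs : Matrix (Fin p) (Fin T) ℝ} {lam τ η A₁ A₂ : ℝ} {s k : ℕ}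

open GaussianModel (excess)

/-- Each row norm of `xᵀ e` is at most `τ` plus its excess. The excess part is paired with `D` by
Cauchy-Schwarz over rows, so it costs a Frobenius norm and not a sum of row norms. -/
theorem frobInner_noise_le (D : Matrix (Fin p) (Fin T) ℝ) :
    frobInner e (x * D) ≤ τ * ∑ j, l2 (D j) + √(excess τ x e) * √(frobSq D) := by
  rw [frobInner_mul_right]
  have h1 : ∀ j, (xᵀ * e) j ⬝ᵥ D j
      ≤ τ * l2 (D j) + max (l2 ((xᵀ * e) j) - τ) 0 * l2 (D j) := by
    intro j
    refine (dotProduct_le_l2_mul _ _).trans ?_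
    rw [← add_mul]
    refine mul_le_mul_of_nonneg_right ?_ (l2_nonneg _)
    linarith [le_max_left (l2 ((xᵀ * e) j) - τ) 0]
  refine (Finset.sum_le_sum fun j _ => h1 j).trans ?_
  rw [Finset.sum_add_distrib, ← Finset.mul_sum, frobSq_eq_sum_rows, excess]
  gcongr
  exact Real.sum_mul_le_sqrt_mul_sqrt _ _ _

theorem sum_rows_le (S : Finset (Fin p)) (D : Matrix (Fin p) (Fin T) ℝ) :
    ∑ j ∈ S, l2 (D j) ≤ √S.card * √(frobSq D) := by
  have h := Real.sum_mul_le_sqrt_mul_sqrt S (fun _ => (1 : ℝ)) (fun j => l2 (D j))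
  simp only [one_mul, one_pow, Finset.sum_const, nsmul_eq_mul, mul_one] at h
  refine h.trans ?_
  gcongr
  rw [frobSq_eq_sum_rows]
  exact Finset.sum_le_univ_sum_of_nonneg fun j => sq_nonneg _

theorem norm_sub_norm_le_support :
    ∑ j, l2 (Bs j) - ∑ j, l2 (B j)
      ≤ 2 * ∑ j ∈ rowSupport Bs, l2 ((B - Bs) j) - ∑ j, l2 ((B - Bs) j) := by
  rw [← Finset.sum_sub_distrib]
  have h1 : ∀ j, l2 (Bs j) - l2 (B j) ≤
      (if j ∈ rowSupport Bs then 2 * l2 ((B - Bs) j) else 0) - l2 ((B - Bs) j) := by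
    intro j
    split_ifs with hj
    · have := l2_add_le (B j) (-(B - Bs) j)
      have e1 : B j + -(B - Bs) j = Bs j := by
        funext t
        simp [Matrix.sub_apply]
      rw [e1, l2_neg] at this
      linarith
    · have h0 : Bs j = 0 := by simpa [mem_rowSupport] using hj
      have e1 : (B - Bs) j = B j := by
        funext t
        simp [Matrix.sub_apply, h0]
      rw [e1, h0, l2_zero]
  refine (Finset.sum_le_sum fun j _ => h1 j).trans_eq ?_
  rw [Finset.sum_sub_distrib, Finset.sum_ite_mem, Finset.univ_inter, Finset.mul_sum]

/-- The noise costs `τ ∑ ‖D_j‖ + τ √s ‖D‖_F`, while the penalty returns `(1 + η) τ ∑ ‖D_j‖` and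
costs `2 (1 + η) τ √s ‖D‖_F`. The surplus `η τ ∑ ‖D_j‖` stays on the left, and `3 + 2η = 2(1 + η) +
1`. -/
theorem IsMultiTaskLasso.basic_inequality (h : IsMultiTaskLasso x (x * Bs + e) lam B)
    (hn : 0 < n) (hT : 0 < T) (hη : 0 < η) (hτ : 0 < τ) (hlam : n * T * lam = (1 + η) * τ)
    (hs : (rowSupport Bs).card ≤ s) (hZ : excess τ x e ≤ s * τ ^ 2) :
    frobSq (x * (B - Bs)) + η * τ * ∑ j, l2 ((B - Bs) j)
      ≤ (3 + 2 * η) * τ * √s * √(frobSq (B - Bs)) := by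
  have hN : (0 : ℝ) < n * T := by positivity
  have hlam0 : 0 ≤ lam := by
    have : 0 < n * T * lam := by rw [hlam]; positivity
    exact (pos_of_mul_pos_right this hN.le).le
  have h1 := h.variational hlam0 hn hT Bs
  set D := B - Bs with hD
  have e1 : x * Bs + e - x * B = e - x * D := by rw [hD, Matrix.mul_sub]; abel
  have e2 : x * (Bs - B) = -(x * D) := by rw [hD, ← Matrix.mul_neg, neg_sub]
  rw [e1, e2, frobInner_neg_right, frobInner_sub_left, frobInner_self, hlam] at h1
  have h2 := frobInner_noise_le (x := x) (e := e) (τ := τ) D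
  have h3 : √(excess τ x e) ≤ √s * τ := by
    refine Real.sqrt_le_iff.2 ⟨by positivity, ?_⟩
    rwa [mul_pow, Real.sq_sqrt (Nat.cast_nonneg s)]
  have h4 : ∑ j ∈ rowSupport Bs, l2 (D j) ≤ √s * √(frobSq D) := by
    refine (sum_rows_le _ _).trans ?_
    gcongr
  have h5 := mul_le_mul_of_nonneg_left (norm_sub_norm_le_support (B := B) (Bs := Bs))
    (by positivity : 0 ≤ (1 + η) * τ)
  rw [← hD] at h5
  have h6 := mul_le_mul_of_nonneg_right h3 (Real.sqrt_nonneg (frobSq D))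
  have h7 := mul_le_mul_of_nonneg_left h4 (by positivity : 0 ≤ 2 * ((1 + η) * τ))
  nlinarith

/-- The basic inequality puts `D` in the cone `∑ ‖D_j‖ ≤ ((3 + 2η)/η) √s ‖D‖_F`. There `hks` makes
the transfer loss at most half of `A₁ ‖D‖_F²`, so `A₁ ‖D‖_F² ≤ 2 ‖x D‖_F²`, which closes the basic
inequality. -/
theorem IsMultiTaskLasso.prediction_bound (h : IsMultiTaskLasso x (x * Bs + e) lam B)
    (hn : 0 < n) (hT : 0 < T) (hη : 0 < η) (hτ : 0 < τ) (hlam : n * T * lam = (1 + η) * τ)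
    (hs : (rowSupport Bs).card ≤ s) (hZ : excess τ x e ≤ s * τ ^ 2)
    (hA₁ : 0 < A₁) (hA₂ : 0 ≤ A₂) (hk : 1 < k) (hiso : IsSparseIsometry x k A₁ A₂)
    (hks : 2 * A₂ * ((3 + 2 * η) / η) ^ 2 * s ≤ (k - 1) * A₁) :
    frobSq (x * (B - Bs)) ≤ 2 * (3 + 2 * η) ^ 2 * τ ^ 2 * s / A₁ := by
  have hb := h.basic_inequality hn hT hη hτ hlam hs hZ
  set D := B - Bs with hD
  set d := ∑ j, l2 (D j) with hd
  have hd0 : 0 ≤ d := Finset.sum_nonneg fun j _ => l2_nonneg _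
  set Q := frobSq (x * D) with hQ
  have hQ0 : 0 ≤ Q := frobSq_nonneg _
  set F := frobSq D with hF
  have hF0 : 0 ≤ F := frobSq_nonneg _
  have hsq : (√s * √F) ^ 2 = s * F := by
    rw [mul_pow, Real.sq_sqrt (Nat.cast_nonneg s), Real.sq_sqrt hF0]
  have h1 : d ≤ (3 + 2 * η) / η * (√s * √F) := by
    rw [div_mul_eq_mul_div, le_div_iff₀ hη]
    have : τ * (d * η) ≤ τ * ((3 + 2 * η) * (√s * √F)) := by nlinarith
    exact le_of_mul_le_mul_left this hτ
  have h2 : d ^ 2 ≤ ((3 + 2 * η) / η) ^ 2 * (s * F) := by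
    rw [← hsq, ← mul_pow]
    exact pow_le_pow_left₀ hd0 h1 2
  have hk' : (0 : ℝ) < (k : ℝ) - 1 := by
    have : (1 : ℝ) < k := by exact_mod_cast hk
    linarith
  have h3 := hiso.frobSq_lower (by omega) hA₁.le hA₂ D
  have h4 : A₁ * F ≤ 2 * Q := by
    have h5 := mul_le_mul_of_nonneg_right hks hF0
    have h6 := mul_le_mul_of_nonneg_left h2 hA₂
    have : ((k : ℝ) - 1) * (A₁ * F) ≤ ((k : ℝ) - 1) * (2 * Q) := by nlinarith
    exact le_of_mul_le_mul_left this hk'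
  have h5 : Q ≤ (3 + 2 * η) * τ * (√s * √F) := by
    have : 0 ≤ η * τ * d := by positivity
    linarith
  have h6 : Q ^ 2 ≤ ((3 + 2 * η) * τ) ^ 2 * (s * F) := by
    rw [← hsq, ← mul_pow]
    exact pow_le_pow_left₀ hQ0 h5 2
  rcases hQ0.eq_or_lt with h0 | h0
  · rw [← h0]; positivity
  · rw [le_div_iff₀ hA₁]
    have h7 := mul_le_mul_of_nonneg_left h4
      (by positivity : 0 ≤ ((3 + 2 * η) * τ) ^ 2 * (s : ℝ))
    have h8 := mul_le_mul_of_nonneg_right h6 hA₁.le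
    have : Q * (Q * A₁) ≤ Q * (2 * (3 + 2 * η) ^ 2 * τ ^ 2 * s) := by nlinarith
    exact le_of_mul_le_mul_left this h0

/-- Duality: if `W` is `xᵀ V` restricted to `S`, then `‖W‖² = ⟨V, x W⟩`. As `W` has at most `k`
nonzero rows, `‖x W‖² ≤ A₂ (1 + k/(k - 1)) ‖W‖²`, and `k ≥ 2` gives the `3`. -/
theorem IsSparseIsometry.frobSq_gram_rows_le (hiso : IsSparseIsometry x k A₁ A₂) (hk : 1 < k)
    (hA₂ : 0 ≤ A₂) (S : Finset (Fin p)) (hS : S.card ≤ k) (V : Matrix (Fin n) (Fin T) ℝ) :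
    ∑ j ∈ S, l2 ((xᵀ * V) j) ^ 2 ≤ 3 * A₂ * frobSq V := by
  classical
  set W : Matrix (Fin p) (Fin T) ℝ := Matrix.of fun j => if j ∈ S then (xᵀ * V) j else 0 with hW
  have hWj : ∀ j, W j = if j ∈ S then (xᵀ * V) j else 0 := fun j => rfl
  have hFW : ∑ j ∈ S, l2 ((xᵀ * V) j) ^ 2 = frobSq W := by
    rw [frobSq_eq_sum_rows, ← Finset.sum_subset (Finset.subset_univ S)]
    · exact Finset.sum_congr rfl fun j hj => by rw [hWj, if_pos hj]
    · intro j _ hj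
      rw [hWj, if_neg hj, l2_zero]
      simp
  have hin : frobSq W = frobInner V (x * W) := by
    rw [frobInner_mul_right, ← hFW, frobInner, ← Finset.sum_subset (Finset.subset_univ S)]
    · exact Finset.sum_congr rfl fun j hj => by rw [hWj, if_pos hj, dotProduct_self_eq_l2_sq]
    · intro j _ hj
      rw [hWj, if_neg hj, dotProduct_zero]
  have hsum : ∑ j, l2 (W j) ≤ √S.card * √(frobSq W) := by
    refine le_trans (le_of_eq ?_) (sum_rows_le S W)
    refine (Finset.sum_subset (Finset.subset_univ S) fun j _ hj => ?_).symm
    rw [hWj, if_neg hj, l2_zero]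
  have hsum2 : (∑ j, l2 (W j)) ^ 2 ≤ k * frobSq W := by
    have := pow_le_pow_left₀ (Finset.sum_nonneg fun j _ => l2_nonneg (W j)) hsum 2
    rw [mul_pow, Real.sq_sqrt (Nat.cast_nonneg _), Real.sq_sqrt (frobSq_nonneg _)] at this
    refine this.trans ?_
    have := frobSq_nonneg W
    gcongr
  have hk2 : (2 : ℝ) ≤ k := by exact_mod_cast hk
  have hF0 := frobSq_nonneg W
  have hup : frobSq (x * W) ≤ 3 * A₂ * frobSq W := by
    have h1 := hiso.frobSq_upper (by omega) hA₂ W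
    have h2 := mul_le_mul_of_nonneg_left hsum2 hA₂
    have h3 : 0 ≤ ((k : ℝ) - 2) * (A₂ * frobSq W) := mul_nonneg (by linarith) (by positivity)
    have : ((k : ℝ) - 1) * frobSq (x * W) ≤ ((k : ℝ) - 1) * (3 * A₂ * frobSq W) := by nlinarith
    exact le_of_mul_le_mul_left this (by linarith)
  rw [hFW]
  rcases hF0.eq_or_lt with h0 | h0
  · rw [← h0]
    have := frobSq_nonneg V
    positivity
  have hcs := frobInner_le V (x * W)
  rw [← hin] at hcs
  have h4 := pow_le_pow_left₀ hF0 hcs 2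
  rw [mul_pow, Real.sq_sqrt (frobSq_nonneg _), Real.sq_sqrt (frobSq_nonneg _)] at h4
  have h5 := mul_le_mul_of_nonneg_left hup (frobSq_nonneg V)
  have : frobSq W * frobSq W ≤ frobSq W * (3 * A₂ * frobSq V) := by nlinarith
  exact le_of_mul_le_mul_left this h0

/-- Otherwise pick exactly `k` active rows, so that the isometry at level `k` applies with no prior
bound on the support. Each must supply `η τ` from its noise excess plus its row of `xᵀ x D`.
Squaring and summing gives `η² k τ² ≤ 2 s τ² + 6 A₂ ‖x D‖_F²`, against `hks'`. -/
theorem IsMultiTaskLasso.card_rowSupport_lt (h : IsMultiTaskLasso x (x * Bs + e) lam B)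
    (hn : 0 < n) (hT : 0 < T) (hη : 0 < η) (hτ : 0 < τ) (hlam : n * T * lam = (1 + η) * τ)
    (hs : (rowSupport Bs).card ≤ s) (hZ : excess τ x e ≤ s * τ ^ 2)
    (hA₁ : 0 < A₁) (hA₂ : 0 ≤ A₂) (hk : 1 < k) (hiso : IsSparseIsometry x k A₁ A₂)
    (hks : 2 * A₂ * ((3 + 2 * η) / η) ^ 2 * s ≤ (k - 1) * A₁)
    (hks' : (2 + 12 * (A₂ / A₁) * (3 + 2 * η) ^ 2) * s < η ^ 2 * k) :
    (rowSupport B).card < k := by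
  by_contra! hcard
  obtain ⟨S, hSB, hSk⟩ := Finset.exists_subset_card_eq hcard
  have hN : (0 : ℝ) < n * T := by positivity
  have hlam0 : 0 ≤ lam := by
    have : 0 < n * T * lam := by rw [hlam]; positivity
    exact (pos_of_mul_pos_right this hN.le).le
  have hQ := h.prediction_bound hn hT hη hτ hlam hs hZ hA₁ hA₂ hk hiso hks
  set D := B - Bs with hD
  have e1 : x * Bs + e - x * B = e - x * D := by rw [hD, Matrix.mul_sub]; abel
  have hrow : ∀ j ∈ S, η ^ 2 * τ ^ 2 ≤ 2 * max (l2 ((xᵀ * e) j) - τ) 0 ^ 2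
      + 2 * l2 ((xᵀ * (x * D)) j) ^ 2 := by
    intro j hj
    have h1 := h.le_l2_of_mem_rowSupport hlam0 hn hT (hSB hj)
    rw [e1, hlam, Matrix.mul_sub] at h1
    have h2 := l2_add_le ((xᵀ * e) j) (-(xᵀ * (x * D)) j)
    rw [l2_neg] at h2
    have e2 : (xᵀ * e - xᵀ * (x * D)) j = (xᵀ * e) j + -(xᵀ * (x * D)) j := by
      funext t
      simp [Matrix.sub_apply, sub_eq_add_neg]
    rw [e2] at h1
    have h3 := le_max_left (l2 ((xᵀ * e) j) - τ) 0
    set m := max (l2 ((xᵀ * e) j) - τ) 0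
    set f := l2 ((xᵀ * (x * D)) j)
    have h4 : η * τ ≤ m + f := by linarith
    have h5 := pow_le_pow_left₀ (by positivity) h4 2
    nlinarith [sq_nonneg (m - f)]
  have hsum := Finset.sum_le_sum hrow
  rw [Finset.sum_const, hSk, nsmul_eq_mul, Finset.sum_add_distrib, ← Finset.mul_sum,
    ← Finset.mul_sum] at hsum
  have h6 : ∑ j ∈ S, max (l2 ((xᵀ * e) j) - τ) 0 ^ 2 ≤ s * τ ^ 2 :=
    (Finset.sum_le_univ_sum_of_nonneg fun j => sq_nonneg _).trans hZ
  have h7 := hiso.frobSq_gram_rows_le hk hA₂ S hSk.le (x * D)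
  have h8 : 3 * A₂ * frobSq (x * D) ≤ 6 * (A₂ / A₁) * (3 + 2 * η) ^ 2 * τ ^ 2 * s := by
    refine (mul_le_mul_of_nonneg_left hQ (by positivity)).trans_eq ?_
    field_simp
    ring
  have hτ2 : 0 < τ ^ 2 := by positivity
  have h9 := mul_lt_mul_of_pos_right hks' hτ2
  linarith

end Bounds

/-! ### Traces and operator norms of positive semidefinite matrices -/

section PosSemidef

variable {ι κ : Type*} [Fintype ι] [Fintype κ]

theorem trace_le_mul_rank [DecidableEq ι] {R : Matrix ι ι ℝ} (hR : R.IsHermitian) {c : ℝ}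
    (hc : ∀ w : ι → ℝ, w ⬝ᵥ (R *ᵥ w) ≤ c * l2 w ^ 2) : R.trace ≤ c * R.rank := by
  have heig : ∀ i, hR.eigenvalues i ≤ c := by
    intro i
    have h1 := hc (hR.eigenvectorBasis i)
    have hn : l2 (hR.eigenvectorBasis i : ι → ℝ) = 1 := by
      simp [l2]
    rw [hR.mulVec_eigenvectorBasis, dotProduct_smul, dotProduct_self_eq_l2_sq, hn] at h1
    simpa using h1
  rw [hR.trace_eq_sum_eigenvalues, hR.rank_eq_card_non_zero_eigs, Fintype.card_subtype,
    ← Finset.sum_filter_ne_zero]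
  refine (Finset.sum_le_card_nsmul _ _ c fun i _ => heig i).trans_eq ?_
  rw [nsmul_eq_mul, mul_comm]
  rfl

/-- Polarization: with `z` the multiple of `A y` having the length of `y`, subtracting the forms at
`z + y` and `z - y` gives `4 ⟨z, A y⟩ ≤ c ‖z + y‖² ≤ 4 c ‖y‖²`. -/
theorem l2_mulVec_le_of_quadForm {A : Matrix ι ι ℝ} (hA : Aᵀ = A) {c : ℝ}
    (h0 : ∀ y : ι → ℝ, 0 ≤ y ⬝ᵥ (A *ᵥ y)) (hc : ∀ y : ι → ℝ, y ⬝ᵥ (A *ᵥ y) ≤ c * l2 y ^ 2)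
    (hc0 : 0 ≤ c) (y : ι → ℝ) : l2 (A *ᵥ y) ≤ c * l2 y := by
  rcases (l2_nonneg (A *ᵥ y)).eq_or_lt with h | h
  · rw [← h]
    exact mul_nonneg hc0 (l2_nonneg y)
  set a := l2 (A *ᵥ y) with ha
  set r := l2 y / a with hr
  have hr0 : 0 ≤ r := div_nonneg (l2_nonneg y) h.le
  set z := r • (A *ᵥ y) with hz
  have hlz : l2 z = l2 y := by
    rw [hz, l2_smul_of_nonneg hr0, ← ha, hr]
    field_simp
  have hsym : y ⬝ᵥ (A *ᵥ z) = z ⬝ᵥ (A *ᵥ y) := by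
    rw [dotProduct_mulVec, ← mulVec_transpose, hA, dotProduct_comm]
  have hzy : z ⬝ᵥ (A *ᵥ y) = l2 y * a := by
    rw [hz, smul_dotProduct, dotProduct_self_eq_l2_sq, ← ha, hr, smul_eq_mul]
    field_simp
  have h1 := hc (z + y)
  have h2 := h0 (z - y)
  have h3 : l2 (z + y) ≤ 2 * l2 y := by linarith [l2_add_le z y]
  have h4 := pow_le_pow_left₀ (l2_nonneg _) h3 2
  have h5 := mul_le_mul_of_nonneg_left h4 hc0
  simp only [mulVec_add, mulVec_sub, add_dotProduct, sub_dotProduct, dotProduct_add,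
    dotProduct_sub] at h1 h2
  have h6 : l2 y * a ≤ l2 y * (c * l2 y) := by nlinarith
  rcases (l2_nonneg y).eq_or_lt with hy | hy
  · have h7 : y = 0 := by
      rw [eq_comm, l2, norm_eq_zero] at hy
      simpa using hy
    rw [ha, h7, mulVec_zero, l2_zero, mul_zero]
  · exact le_of_mul_le_mul_left h6 hy

theorem l2_mulVec_le_frobSq (M : Matrix ι κ ℝ) (v : κ → ℝ) :
    l2 (M *ᵥ v) ≤ √(frobSq M) * l2 v := by
  refine (sq_le_sq₀ (l2_nonneg _) (mul_nonneg (Real.sqrt_nonneg _) (l2_nonneg _))).1 ?_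
  rw [mul_pow, Real.sq_sqrt (frobSq_nonneg _), frobSq_eq_sum_rows, Finset.sum_mul, l2_sq]
  refine Finset.sum_le_sum fun i _ => ?_
  rw [← mul_pow]
  refine sq_le_sq.2 ?_
  rw [abs_of_nonneg (mul_nonneg (l2_nonneg _) (l2_nonneg _)), abs_le]
  refine ⟨?_, dotProduct_le_l2_mul _ _⟩
  have := dotProduct_le_l2_mul (-M i) v
  rw [l2_neg, neg_dotProduct] at this
  exact neg_le.1 this

theorem IsMoorePenrose.transpose {A : Matrix ι κ ℝ} {G : Matrix κ ι ℝ} (h : IsMoorePenrose A G) :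
    IsMoorePenrose Aᵀ Gᵀ where
  mul_mul_self := by rw [← transpose_mul, ← transpose_mul, ← Matrix.mul_assoc, h.mul_mul_self]
  self_mul_mul := by rw [← transpose_mul, ← transpose_mul, ← Matrix.mul_assoc, h.self_mul_mul]
  symm_left := by rw [← transpose_mul, h.symm_right, h.symm_right]
  symm_right := by rw [← transpose_mul, h.symm_left, h.symm_left]

theorem pinv_transpose_of_symm {A : Matrix ι ι ℝ} (hA : Aᵀ = A) : (pinv A)ᵀ = pinv A := by
  have h := (pinv_spec A).transpose
  rw [hA] at h
  exact h.unique (pinv_spec A)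

/-- The ridge-type hat matrix `Z (ZᵀZ + H)⁺ Zᵀ` is positive semidefinite and a contraction. -/
theorem pinv_gram_quadForm {Z : Matrix ι κ ℝ} {H : Matrix κ κ ℝ} (hH : H.PosSemidef)
    (v : ι → ℝ) :
    0 ≤ (Zᵀ *ᵥ v) ⬝ᵥ (pinv (Zᵀ * Z + H) *ᵥ (Zᵀ *ᵥ v)) ∧
      (Zᵀ *ᵥ v) ⬝ᵥ (pinv (Zᵀ * Z + H) *ᵥ (Zᵀ *ᵥ v)) ≤ l2 v ^ 2 := by
  have hHt : Hᵀ = H := by simpa [conjTranspose_eq_transpose_of_trivial] using hH.isHermitian.eq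
  have hN : (Zᵀ * Z + H)ᵀ = Zᵀ * Z + H := by simp [hHt]
  set G := pinv (Zᵀ * Z + H) with hG
  have hGt : Gᵀ = G := pinv_transpose_of_symm hN
  have hGNG : G * (Zᵀ * Z + H) * G = G := (pinv_spec _).self_mul_mul
  set a := Zᵀ *ᵥ v with ha
  set g := G *ᵥ a with hg
  have h1 : a ⬝ᵥ g = l2 (Z *ᵥ g) ^ 2 + g ⬝ᵥ (H *ᵥ g) := by
    have e1 : a ⬝ᵥ g = g ⬝ᵥ ((Zᵀ * Z + H) *ᵥ g) := by
      calc a ⬝ᵥ g = a ⬝ᵥ ((G * (Zᵀ * Z + H) * G) *ᵥ a) := by rw [hGNG]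
        _ = a ⬝ᵥ (G *ᵥ ((Zᵀ * Z + H) *ᵥ g)) := by simp only [hg, mulVec_mulVec, Matrix.mul_assoc]
        _ = g ⬝ᵥ ((Zᵀ * Z + H) *ᵥ g) := by
          rw [dotProduct_mulVec, ← mulVec_transpose, hGt]
    rw [e1, add_mulVec, dotProduct_add, ← mulVec_mulVec, dotProduct_mulVec, vecMul_transpose,
      dotProduct_self_eq_l2_sq]
  have h2 : a ⬝ᵥ g = v ⬝ᵥ (Z *ᵥ g) := by
    rw [ha, mulVec_transpose, ← dotProduct_mulVec]
  have h3 : 0 ≤ g ⬝ᵥ (H *ᵥ g) := by simpa using hH.dotProduct_mulVec_nonneg g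
  refine ⟨by rw [h1]; positivity, ?_⟩
  -- Now `‖Z g‖² ≤ a·g ≤ ‖v‖ ‖Z g‖`, which forces `a·g ≤ ‖v‖²`. Only `G N G = G` was used of the
  -- pseudoinverse, besides its symmetry.
  have h4 := dotProduct_le_l2_mul v (Z *ᵥ g)
  nlinarith [sq_nonneg (l2 v - l2 (Z *ᵥ g))]

end PosSemidef

/-! ### The interaction matrix -/

section Interaction

variable {n p T : ℕ}

theorem hessBlock_posSemidef {lam : ℝ} (hlam : 0 ≤ lam) (u : Fin T → ℝ) :
    (hessBlock lam u).PosSemidef := by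
  have hl := l2_nonneg u
  refine PosSemidef.smul (PosSemidef.of_dotProduct_mulVec_nonneg ?_ fun v => ?_) (by positivity)
  · ext i j
    simp [vecMulVec_apply, one_apply, mul_comm, eq_comm]
  · simp only [star_trivial, sub_mulVec, one_mulVec, smul_mulVec, vecMulVec_mulVec,
      dotProduct_sub, dotProduct_smul, dotProduct_self_eq_l2_sq]
    rcases hl.eq_or_lt with h0 | h0
    · rw [← h0]
      simp [sq_nonneg]
    · have h1 : (u ⬝ᵥ v) ^ 2 ≤ (l2 u * l2 v) ^ 2 := by
        refine sq_le_sq.2 ?_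
        rw [abs_of_nonneg (mul_nonneg (l2_nonneg _) (l2_nonneg _)), abs_le]
        refine ⟨?_, dotProduct_le_l2_mul _ _⟩
        have := dotProduct_le_l2_mul (-u) v
        rw [l2_neg, neg_dotProduct] at this
        exact neg_le.1 this
      have h2 : (l2 u ^ 2)⁻¹ * (u ⬝ᵥ v) ^ 2 ≤ l2 v ^ 2 := by
        rw [inv_mul_le_iff₀ (by positivity)]
        linarith
      have h3 : v ⬝ᵥ u = u ⬝ᵥ v := dotProduct_comm _ _
      simp only [smul_eq_mul, MulOpposite.smul_eq_mul_unop, MulOpposite.unop_op, h3]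
      nlinarith

theorem tildeH_posSemidef {lam : ℝ} (hlam : 0 ≤ lam) (B : Matrix (Fin p) (Fin T) ℝ) :
    (tildeH lam B).PosSemidef := by
  refine Matrix.posSemidef_sum _ fun j _ => ?_
  refine (hessBlock_posSemidef hlam _).kronecker ?_
  rw [← diagonal_single]
  refine PosSemidef.diagonal fun i => ?_
  by_cases h : i = j
  · subst h; simp
  · simp [h]

theorem rank_restrictCols_le (X : Matrix (Fin n) (Fin p) ℝ) (S : Finset (Fin p)) :
    (restrictCols X S).rank ≤ S.card := by
  classical
  have h1 : restrictCols X S = X * diagonal fun j => if j ∈ S then (1 : ℝ) else 0 := by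
    ext i j
    simp [restrictCols]
  rw [h1]
  refine (rank_mul_le_right _ _).trans ?_
  rw [rank_diagonal, Fintype.card_subtype]
  simp

variable (X : Matrix (Fin n) (Fin p) ℝ) (B : Matrix (Fin p) (Fin T) ℝ)

/-- The linear combination of the block rows with coefficients `y`. -/
noncomputable def blockComb (y : Fin T → ℝ) : Matrix (Fin n) (Fin T × Fin p) ℝ :=
  Matrix.of fun i q => y q.1 * restrictCols X (rowSupport B) i q.2

theorem blockComb_eq_sum (y : Fin T → ℝ) : blockComb X B y = ∑ t, y t • blockRow X B t := by
  ext i q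
  simp [blockComb, blockRow, Matrix.sum_apply]

theorem dotProduct_interaction_mulVec (lam : ℝ) (y : Fin T → ℝ) :
    y ⬝ᵥ (interaction X lam B *ᵥ y) = (blockComb X B y
      * pinv ((tildeX X B)ᵀ * tildeX X B + ((n : ℝ) * (T : ℝ)) • tildeH lam B)
      * (blockComb X B y)ᵀ).trace := by
  rw [blockComb_eq_sum]
  simp only [transpose_sum, transpose_smul, Matrix.sum_mul, Matrix.mul_sum, Matrix.smul_mul,
    Matrix.mul_smul, trace_sum, trace_smul, smul_eq_mul, dotProduct, mulVec, interaction, of_apply,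
    Finset.mul_sum]
  rw [Finset.sum_comm]
  refine Finset.sum_congr rfl fun i _ => Finset.sum_congr rfl fun j _ => ?_
  ring

theorem blockComb_transpose_mulVec (y : Fin T → ℝ) (w : Fin n → ℝ) :
    (blockComb X B y)ᵀ *ᵥ w = (tildeX X B)ᵀ *ᵥ fun q => y q.1 * w q.2 := by
  funext q
  simp only [mulVec, dotProduct, transpose_apply, blockComb, of_apply, tildeX,
    kroneckerMap_apply, Fintype.sum_prod_type, one_apply]
  simp [mul_assoc, mul_left_comm]

/-- The matrix is `yᵀ ⊗ X_S`, which factors through `X_S`; hence the bound is free of `T`. -/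
theorem rank_blockComb_le (y : Fin T → ℝ) : (blockComb X B y).rank ≤ (rowSupport B).card := by
  have h1 : blockComb X B y = restrictCols X (rowSupport B) *
      Matrix.of fun (j : Fin p) (q : Fin T × Fin p) => if j = q.2 then y q.1 else 0 := by
    ext i q
    simp [blockComb, Matrix.mul_apply, mul_comm]
  rw [h1]
  exact (rank_mul_le_left _ _).trans (rank_restrictCols_le _ _)

variable {lam : ℝ} (hlam : 0 ≤ lam)
include hlam

/-- The form is the trace of an `n × n` matrix `R`, and `w ↦ wᵀ R w` is the ridge hat form at `y ⊗
w`. So `0 ≤ R ≤ ‖y‖² I`, and its trace is at most `‖y‖²` times its rank. -/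
theorem interaction_quadForm (y : Fin T → ℝ) :
    0 ≤ y ⬝ᵥ (interaction X lam B *ᵥ y) ∧
      y ⬝ᵥ (interaction X lam B *ᵥ y) ≤ (rowSupport B).card * l2 y ^ 2 := by
  have hH : (((n : ℝ) * (T : ℝ)) • tildeH lam B).PosSemidef :=
    (tildeH_posSemidef hlam B).smul (by positivity)
  have hHt : (((n : ℝ) * (T : ℝ)) • tildeH lam B)ᵀ = ((n : ℝ) * (T : ℝ)) • tildeH lam B := by
    simpa [conjTranspose_eq_transpose_of_trivial] using hH.isHermitian.eq
  rw [dotProduct_interaction_mulVec]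
  set G := pinv ((tildeX X B)ᵀ * tildeX X B + ((n : ℝ) * (T : ℝ)) • tildeH lam B) with hG
  set R := blockComb X B y * G * (blockComb X B y)ᵀ with hR
  have hGt : Gᵀ = G := pinv_transpose_of_symm (by
    rw [transpose_add, hHt, transpose_mul, transpose_transpose])
  have hRq : ∀ w : Fin n → ℝ, w ⬝ᵥ (R *ᵥ w) = ((blockComb X B y)ᵀ *ᵥ w) ⬝ᵥ
      (G *ᵥ ((blockComb X B y)ᵀ *ᵥ w)) := by
    intro w
    rw [hR, ← mulVec_mulVec, ← mulVec_mulVec, dotProduct_mulVec, ← mulVec_transpose]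
  have hnorm : ∀ w : Fin n → ℝ, l2 (fun q : Fin T × Fin n => y q.1 * w q.2) ^ 2
      = l2 y ^ 2 * l2 w ^ 2 := by
    intro w
    simp only [l2_sq, Fintype.sum_prod_type, mul_pow, Finset.sum_mul_sum]
  have hRh : R.IsHermitian := by
    rw [Matrix.IsHermitian, conjTranspose_eq_transpose_of_trivial, hR, transpose_mul,
      transpose_mul, transpose_transpose, hGt, Matrix.mul_assoc]
  have hq : ∀ w, 0 ≤ w ⬝ᵥ (R *ᵥ w) ∧ w ⬝ᵥ (R *ᵥ w) ≤ l2 y ^ 2 * l2 w ^ 2 := by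
    intro w
    rw [hRq, ← hnorm, blockComb_transpose_mulVec]
    exact pinv_gram_quadForm hH _
  constructor
  · exact (PosSemidef.of_dotProduct_mulVec_nonneg hRh fun w => by
      simpa using (hq w).1).trace_nonneg
  · refine (trace_le_mul_rank hRh fun w => (hq w).2).trans ?_
    rw [mul_comm]
    refine mul_le_mul_of_nonneg_right ?_ (sq_nonneg _)
    rw [hR, Matrix.mul_assoc]
    exact_mod_cast (rank_mul_le_left _ _).trans (rank_blockComb_le X B y)

theorem interaction_transpose : (interaction X lam B)ᵀ = interaction X lam B := by
  have hH : (((n : ℝ) * (T : ℝ)) • tildeH lam B)ᵀ = ((n : ℝ) * (T : ℝ)) • tildeH lam B := by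
    simpa [conjTranspose_eq_transpose_of_trivial] using
      ((tildeH_posSemidef hlam B).smul (by positivity : 0 ≤ (n : ℝ) * (T : ℝ))).isHermitian.eq
  have hGt := pinv_transpose_of_symm
    (A := (tildeX X B)ᵀ * tildeX X B + ((n : ℝ) * (T : ℝ)) • tildeH lam B) (by
      rw [transpose_add, hH, transpose_mul, transpose_transpose])
  ext t t'
  simp only [transpose_apply, interaction, of_apply]
  rw [← trace_transpose, transpose_mul, transpose_mul, transpose_transpose, hGt, Matrix.mul_assoc]

theorem l2_interaction_mulVec_le (y : Fin T → ℝ) :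
    l2 (interaction X lam B *ᵥ y) ≤ (rowSupport B).card * l2 y :=
  l2_mulVec_le_of_quadForm (interaction_transpose X B hlam)
    (fun y => (interaction_quadForm X B hlam y).1) (fun y => (interaction_quadForm X B hlam y).2)
    (Nat.cast_nonneg _) y

theorem l2_adjustment_mulVec (hn : 0 < n) {m : ℝ} (hm : (rowSupport B).card ≤ m)
    (y : Fin T → ℝ) : l2 (y - adjustment X lam B *ᵥ y) ≤ m / n * l2 y := by
  have hn' : (0 : ℝ) < n := by exact_mod_cast hn
  have e1 : y - adjustment X lam B *ᵥ y = (n : ℝ)⁻¹ • (interaction X lam B *ᵥ y) := by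
    rw [adjustment, sub_mulVec, one_mulVec, smul_mulVec, sub_sub_cancel]
  rw [e1, l2_smul_of_nonneg (by positivity)]
  have h1 := l2_interaction_mulVec_le X B hlam y
  have h2 := mul_le_mul_of_nonneg_right hm (l2_nonneg y)
  rw [div_mul_eq_mul_div, inv_mul_eq_div]
  gcongr
  linarith

theorem isUnit_det_adjustment (hn : 0 < n) {m : ℝ} (hm : (rowSupport B).card ≤ m)
    (hmn : m / n ≤ 1 / 2) : IsUnit (adjustment X lam B).det := by
  rw [isUnit_iff_ne_zero]
  intro h0
  obtain ⟨v, hv, hv0⟩ := exists_mulVec_eq_zero_iff.2 h0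
  have h1 := l2_adjustment_mulVec X B hlam hn hm v
  rw [hv0, sub_zero] at h1
  have h2 := l2_pos hv
  nlinarith

/-- The adjusted residual is close to the noise in the direction `b`. -/
theorem l2_adjustedResidual_sub_le (hn : 0 < n) {m : ℝ} (hm : (rowSupport B).card ≤ m)
    (hmn : m / n ≤ 1 / 2) (e : Matrix (Fin n) (Fin T) ℝ) (Bs : Matrix (Fin p) (Fin T) ℝ)
    {b : Fin T → ℝ} (hb : l2 b = 1) :
    |l2 (adjustedResidual X (X * Bs + e) lam B b) - l2 (e *ᵥ b)|
      ≤ √(frobSq e) * (2 * (m / n)) + 2 * √(frobSq (X * (B - Bs))) := by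
  have hdet := isUnit_det_adjustment X B hlam hn hm hmn
  -- From `‖v - b‖ ≤ (m/n) ‖v‖` and `m/n ≤ 1/2` follow `‖v‖ ≤ 2` and then `‖v - b‖ ≤ 2 m/n`.
  set v := (adjustment X lam B)⁻¹ *ᵥ b with hv
  have hDv : adjustment X lam B *ᵥ v = b := by
    rw [hv, mulVec_mulVec, Matrix.mul_nonsing_inv _ hdet, one_mulVec]
  have h1 := l2_adjustment_mulVec X B hlam hn hm v
  rw [hDv] at h1
  have h2 : l2 v ≤ l2 b + l2 (v - b) := by
    have := l2_add_le b (v - b)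
    rwa [add_sub_cancel] at this
  have hv2 : l2 v ≤ 2 := by
    rw [hb] at h2
    nlinarith [l2_nonneg v]
  have hm0 : 0 ≤ m / n := div_nonneg ((Nat.cast_nonneg _).trans hm) (Nat.cast_nonneg _)
  have hvb : l2 (v - b) ≤ 2 * (m / n) := h1.trans (by nlinarith)
  set r := adjustedResidual X (X * Bs + e) lam B b with hr
  set d := e *ᵥ (v - b) + -((X * (B - Bs)) *ᵥ v) with hd
  have hrd : r = e *ᵥ b + d := by
    rw [hr, adjustedResidual, ← mulVec_mulVec, ← hv, hd]
    have : X * Bs + e - X * B = e - X * (B - Bs) := by rw [Matrix.mul_sub]; abel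
    rw [this, sub_mulVec, mulVec_sub]
    abel
  have hdl : l2 d ≤ √(frobSq e) * (2 * (m / n)) + 2 * √(frobSq (X * (B - Bs))) := by
    refine (l2_add_le _ _).trans ?_
    rw [l2_neg]
    have h3 := l2_mulVec_le_frobSq e (v - b)
    have h4 := l2_mulVec_le_frobSq (X * (B - Bs)) v
    have h5 := mul_le_mul_of_nonneg_left hvb (Real.sqrt_nonneg (frobSq e))
    have h6 := mul_le_mul_of_nonneg_left hv2 (Real.sqrt_nonneg (frobSq (X * (B - Bs))))
    linarith
  refine le_trans (abs_le.2 ⟨?_, ?_⟩) hdl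
  · have := l2_add_le r (-d)
    rw [l2_neg, hrd, add_neg_cancel_right] at this
    rw [hrd]
    linarith
  · have := l2_add_le (e *ᵥ b) d
    rw [hrd]
    linarith

end Interaction

/-! ### The standard normal quantile -/

theorem gaussianReal_Iic_zero_le : (gaussianReal 0 1).real (Set.Iic 0) ≤ 1 / 2 := by
  have h1 : (gaussianReal 0 1) (Set.Ici 0) = (gaussianReal 0 1) (Set.Iic 0) := by
    have h := gaussianReal_map_neg (μ := 0) (v := 1)
    rw [neg_zero] at h
    conv_lhs => rw [← h]
    rw [Measure.map_apply (by fun_prop) measurableSet_Ici]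
    congr 1
    ext x
    simp
  have := nullSingletonClass_gaussianReal (μ := 0) (v := 1) one_ne_zero
  have h2 : (gaussianReal 0 1) (Set.Ioi 0) = (gaussianReal 0 1) (Set.Ici 0) :=
    measure_congr Ioi_ae_eq_Ici
  have h3 : (gaussianReal 0 1).real (Set.Iic 0) + (gaussianReal 0 1).real (Set.Iic 0)ᶜ = 1 := by
    rw [measureReal_compl measurableSet_Iic]
    simp
  have h4 : (gaussianReal 0 1).real (Set.Iic 0)ᶜ = (gaussianReal 0 1).real (Set.Iic 0) := by
    rw [Set.compl_Iic, Measure.real, Measure.real, h2, h1]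
  linarith

/-- Positivity lets the quantile cancel from the length ratio. Right continuity of the distribution
function at `0` gives a positive lower bound for the defining set; the set must be shown nonempty,
since `sInf ∅ = 0`. -/
theorem stdNormalQuantile_pos {q : ℝ} (hq : 1 / 2 < q) (hq1 : q < 1) : 0 < stdNormalQuantile q := by
  have h0 : cdf (gaussianReal 0 1) 0 < q := by
    rw [cdf_eq_real]
    exact gaussianReal_Iic_zero_le.trans_lt hq
  obtain ⟨δ, hδ, hδq⟩ : ∃ δ : ℝ, 0 < δ ∧ cdf (gaussianReal 0 1) δ < q := by
    have hc := (cdf (gaussianReal 0 1)).right_continuous 0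
    have h1 : ∀ᶠ x in 𝓝[≥] (0 : ℝ), cdf (gaussianReal 0 1) x < q :=
      hc.eventually (gt_mem_nhds h0)
    obtain ⟨x, hx, hxq⟩ := ((h1.filter_mono (nhdsWithin_mono 0 Set.Ioi_subset_Ici_self)).and
      self_mem_nhdsWithin).exists
    exact ⟨x, hxq, hx⟩
  have hne : {x : ℝ | q ≤ cdf (gaussianReal 0 1) x}.Nonempty := by
    obtain ⟨x, hx⟩ := ((tendsto_cdf_atTop (gaussianReal 0 1)).eventually (lt_mem_nhds hq1)).exists
    exact ⟨x, hx.le⟩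
  refine hδ.trans_le (le_csInf hne fun x hx => ?_)
  by_contra! hlt
  have := monotone_cdf (gaussianReal 0 1) hlt.le
  have hx' : q ≤ cdf (gaussianReal 0 1) x := hx
  linarith

/-! ### Concentration of the adjusted residual -/

section Concentration

variable {n p T s : ℕ}

theorem diag_le_iSup_sq {Sig : Matrix (Fin p) (Fin p) ℝ} (hpos : ∀ j, 0 < Sig j j) (j : Fin p) :
    Sig j j ≤ (⨆ j, √(Sig j j)) ^ 2 := by
  have h1 : √(Sig j j) ≤ ⨆ j, √(Sig j j) :=
    le_ciSup (Set.finite_range fun j => √(Sig j j)).bddAbove j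
  have h2 := pow_le_pow_left₀ (Real.sqrt_nonneg _) h1 2
  rwa [Real.sq_sqrt (hpos j).le] at h2

/-- Matches `n T λ₀` with the threshold of `measure_excess_le`; the factor `1 + η₁` pays for the
fluctuation of the column norms of `X`. -/
theorem natCast_mul_lambda0 {η₁ σ : ℝ} (hη : 0 < η₁) (hσ : 0 < σ) (hn : 0 < n) (hT : 0 < T)
    (Sig : Matrix (Fin p) (Fin p) ℝ) :
    n * T * lambda0 η₁ σ n p T s Sig
      = √((σ * (1 + η₁) * ⨆ j, √(Sig j j)) ^ 2 * n * T)
        * (1 + √(2 * Real.log (p / s) / T)) := by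
  have hM : 0 ≤ ⨆ j, √(Sig j j) := Real.iSup_nonneg fun j => Real.sqrt_nonneg _
  have hN : (0 : ℝ) < n * T := by positivity
  rw [mul_assoc (_ ^ 2), Real.sqrt_mul (by positivity), Real.sqrt_sq (by positivity), lambda0]
  have h1 : √((n : ℝ) * T) * √((n : ℝ) * T) = n * T := Real.mul_self_sqrt hN.le
  have h2 : √((n : ℝ) * T) ≠ 0 := (Real.sqrt_pos.2 hN).ne'
  have h3 : 2 / (T : ℝ) * Real.log (p / s) = 2 * Real.log (p / s) / T := by ring
  have h4 : (n : ℝ) * T / √((n : ℝ) * T) = √((n : ℝ) * T) := by rw [div_eq_iff h2, h1]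
  calc _ = σ * (1 + η₁) * (⨆ j, √(Sig j j)) * ((n : ℝ) * T / √((n : ℝ) * T))
        * (1 + √(2 / (T : ℝ) * Real.log (p / s))) := by ring
    _ = _ := by rw [h3, h4]

theorem mul_one_add_sqrt_sq_le {L : ℝ} (hL : 0 ≤ L) (hT : 0 < T) :
    T * (1 + √(2 * L / T)) ^ 2 ≤ 4 * (T + L) := by
  have hT' : (0 : ℝ) < T := by exact_mod_cast hT
  have h1 : √(2 * L / T) ^ 2 = 2 * L / T := Real.sq_sqrt (by positivity)
  have h2 : (1 + √(2 * L / T)) ^ 2 ≤ 2 + 2 * (2 * L / T) := by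
    nlinarith [sq_nonneg (1 - √(2 * L / T))]
  calc T * (1 + √(2 * L / T)) ^ 2 ≤ T * (2 + 2 * (2 * L / T)) := by gcongr
    _ = 2 * T + 4 * L := by field_simp; ring
    _ ≤ _ := by linarith

/-- The effective rate `(s / n) (T + log (p / s))`. -/
noncomputable def rate (n p T s : ℕ) : ℝ := (s : ℝ) / n * (T + Real.log (p / s))

/-- The deterministic part of the error bound. -/
noncomputable def errorBound (σ Cmin η₁ η₂ : ℝ) (K : ℕ) (δ ρ : ℝ) : ℝ :=
  σ * δ + 4 * σ * K * ρ
    + 2 * √(32 * ((3 + 2 * η₂) * (σ * (1 + η₁))) ^ 2 / Cmin * ρ)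

/-- A constant large enough for the estimate to have at most `K * s` nonzero rows. -/
structure IsSparsityConstant (Cmin Cmax η₂ : ℝ) (K : ℕ) : Prop where
  two_le : 2 ≤ K
  cone : 2 * (16 * Cmax / Cmin) * ((3 + 2 * η₂) / η₂) ^ 2 + 1 ≤ K
  support : 2 + 12 * (16 * Cmax / Cmin) * (3 + 2 * η₂) ^ 2 < η₂ ^ 2 * K

theorem exists_isSparsityConstant (Cmin Cmax : ℝ) {η₂ : ℝ} (hη : 0 < η₂) :
    ∃ K, IsSparsityConstant Cmin Cmax η₂ K := by
  have hη2 : 0 < η₂ ^ 2 := by positivity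
  have h2 : ∀ᶠ K : ℕ in atTop,
      2 + 12 * (16 * Cmax / Cmin) * (3 + 2 * η₂) ^ 2 < η₂ ^ 2 * K :=
    (tendsto_natCast_atTop_atTop.const_mul_atTop hη2).eventually_gt_atTop _
  have h1 : ∀ᶠ K : ℕ in atTop,
      2 * (16 * Cmax / Cmin) * ((3 + 2 * η₂) / η₂) ^ 2 + 1 ≤ K :=
    tendsto_natCast_atTop_atTop.eventually_ge_atTop _
  obtain ⟨K, hK⟩ := ((eventually_ge_atTop 2).and (h1.and h2)).exists
  exact ⟨K, hK.1, hK.2.1, hK.2.2⟩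

-- The deterministic half: on the good event, the Lasso bounds at sparsity level `k = K s` are
-- expressed through the rate.
set_option maxHeartbeats 1000000 in
theorem IsMultiTaskLasso.adjustedResidual_bound {σ Cmin Cmax η₁ η₂ : ℝ} {K : ℕ} (hσ : 0 < σ)
    (hCmin : 0 < Cmin) (hCmax : 0 ≤ Cmax) (hη₁ : 0 < η₁) (hη₂ : 0 < η₂)
    (hK : IsSparsityConstant Cmin Cmax η₂ K)
    (hn : 0 < n) (hT : 0 < T) (hs : 0 < s) (hL : 0 < Real.log (p / s))
    (hKs : (K * s : ℝ) / n ≤ 1 / 2)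
    {Sig : Matrix (Fin p) (Fin p) ℝ} (hMpos : 0 < ⨆ j, √(Sig j j)) (hM1 : (⨆ j, √(Sig j j)) ≤ 1)
    {x : Matrix (Fin n) (Fin p) ℝ} {e : Matrix (Fin n) (Fin T) ℝ}
    {B Bs : Matrix (Fin p) (Fin T) ℝ} (hBs : (rowSupport Bs).card ≤ s) {lam : ℝ}
    (hlam : lam = (1 + η₂) * lambda0 η₁ σ n p T s Sig)
    (hB : IsMultiTaskLasso x (x * Bs + e) lam B) {b : Fin T → ℝ} (hb : l2 b = 1) {δ : ℝ}
    (hiso : IsSparseIsometry x (K * s) (Cmin * n / 4) (Cmax * n * 4))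
    (hexc : GaussianModel.excess (n * T * lambda0 η₁ σ n p T s Sig) x e
      ≤ s * (n * T * lambda0 η₁ σ n p T s Sig) ^ 2)
    (hnoise : frobSq e ≤ σ ^ 2 * (n * T) * 4)
    (hdir : |l2 (e *ᵥ b) - σ * √n| ≤ σ * √n * δ) :
    IsUnit (adjustment x lam B).det ∧
      |l2 (adjustedResidual x (x * Bs + e) lam B b) / √n - σ|
        ≤ errorBound σ Cmin η₁ η₂ K δ (rate n p T s) := by
  set τ := n * T * lambda0 η₁ σ n p T s Sig with hτ
  set M := ⨆ j, √(Sig j j) with hM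
  set L := Real.log (p / s) with hLdef
  have hn' : (0 : ℝ) < n := by exact_mod_cast hn
  have hT' : (0 : ℝ) < T := by exact_mod_cast hT
  have hT1 : (1 : ℝ) ≤ T := by exact_mod_cast hT
  have hs' : (1 : ℝ) ≤ s := by exact_mod_cast hs
  have hτe : τ = √((σ * (1 + η₁) * M) ^ 2 * n * T) * (1 + √(2 * L / T)) :=
    natCast_mul_lambda0 hη₁ hσ hn hT Sig
  have hτ0 : 0 < τ := by rw [hτe]; positivity
  have hτ2 : τ ^ 2 ≤ (σ * (1 + η₁)) ^ 2 * n * (4 * (T + L)) := by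
    rw [hτe, mul_pow, Real.sq_sqrt (by positivity)]
    have h1 := mul_one_add_sqrt_sq_le hL.le hT
    calc (σ * (1 + η₁) * M) ^ 2 * n * T * (1 + √(2 * L / T)) ^ 2
        = (σ * (1 + η₁) * M) ^ 2 * n * (T * (1 + √(2 * L / T)) ^ 2) := by ring
      _ ≤ (σ * (1 + η₁) * 1) ^ 2 * n * (4 * (T + L)) := by gcongr
      _ = _ := by ring
  have hlamτ : n * T * lam = (1 + η₂) * τ := by rw [hlam, hτ]; ring
  have hlam0 : 0 ≤ lam := by
    have : 0 < n * T * lam := by rw [hlamτ]; positivity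
    exact (pos_of_mul_pos_right this (by positivity)).le
  have hK2 : (2 : ℝ) ≤ K := by exact_mod_cast hK.two_le
  have hk1 : 1 < K * s := by nlinarith [hK.two_le]
  have hA : Cmax * n * 4 / (Cmin * n / 4) = 16 * Cmax / Cmin := by field_simp; norm_num
  have hcone : 2 * (Cmax * n * 4) * ((3 + 2 * η₂) / η₂) ^ 2 * s
      ≤ ((K * s : ℕ) - 1) * (Cmin * n / 4) := by
    have h1 : Cmax * n * 4 = 16 * Cmax / Cmin * (Cmin * n / 4) := by rw [← hA]; field_simp
    have h2 : 2 * (16 * Cmax / Cmin) * ((3 + 2 * η₂) / η₂) ^ 2 * s ≤ ((K * s : ℕ) : ℝ) - 1 := by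
      push_cast
      have h := mul_le_mul_of_nonneg_right hK.cone (by linarith : (0 : ℝ) ≤ s)
      rw [add_mul, one_mul] at h
      linarith
    rw [h1]
    have h3 := mul_le_mul_of_nonneg_right h2 (by positivity : 0 ≤ Cmin * n / 4)
    linarith
  have hsupp : (2 + 12 * (Cmax * n * 4 / (Cmin * n / 4)) * (3 + 2 * η₂) ^ 2) * s
      < η₂ ^ 2 * (K * s : ℕ) := by
    rw [hA]
    push_cast
    have h := mul_lt_mul_of_pos_right hK.support (by linarith : (0 : ℝ) < s)
    rwa [mul_assoc (η₂ ^ 2)] at h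
  have hcard := hB.card_rowSupport_lt hn hT hη₂ hτ0 hlamτ hBs hexc (by positivity) (by positivity)
    hk1 hiso hcone hsupp
  have hpred := hB.prediction_bound hn hT hη₂ hτ0 hlamτ hBs hexc (by positivity) (by positivity)
    hk1 hiso hcone
  have hm : ((rowSupport B).card : ℝ) ≤ K * s := by exact_mod_cast hcard.le
  refine ⟨isUnit_det_adjustment x B hlam0 hn hm hKs, ?_⟩
  have hres := l2_adjustedResidual_sub_le x B hlam0 hn hm hKs e Bs hb
  set r := l2 (adjustedResidual x (x * Bs + e) lam B b) with hr
  set ρ := rate n p T s with hρ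
  have hρe : ρ = s / n * (T + L) := rfl
  have hρ0 : 0 ≤ ρ := by rw [hρe]; positivity
  have hsn : 0 < √(n : ℝ) := Real.sqrt_pos.2 hn'
  have hsnn : √(n : ℝ) * √(n : ℝ) = n := Real.mul_self_sqrt hn'.le
  -- The factor `√T` is enlarged to `T`, so that its product with `s/n` is bounded by the rate.
  have h1 : √(frobSq e) ≤ 2 * σ * √n * T := by
    refine Real.sqrt_le_iff.2 ⟨by positivity, hnoise.trans ?_⟩
    have : (2 * σ * √n * T) ^ 2 = σ ^ 2 * (n * (T * T)) * 4 := by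
      rw [mul_pow, mul_pow, mul_pow, Real.sq_sqrt hn'.le]
      ring
    rw [this]
    have : (T : ℝ) * 1 ≤ T * T := by gcongr
    rw [mul_one] at this
    gcongr
  have h2 : √(frobSq e) * (2 * (K * s / n)) ≤ √n * (4 * σ * K * ρ) := by
    calc √(frobSq e) * (2 * (K * s / n)) ≤ 2 * σ * √n * T * (2 * (K * s / n)) := by gcongr
      _ = √n * (4 * σ * K * (s / n * T)) := by ring
      _ ≤ √n * (4 * σ * K * ρ) := by
        rw [hρe]
        gcongr
        linarith
  have h3 : √(frobSq (x * (B - Bs)))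
      ≤ √n * √(32 * ((3 + 2 * η₂) * (σ * (1 + η₁))) ^ 2 / Cmin * ρ) := by
    rw [← Real.sqrt_mul hn'.le]
    refine Real.sqrt_le_sqrt (hpred.trans ?_)
    calc 2 * (3 + 2 * η₂) ^ 2 * τ ^ 2 * s / (Cmin * n / 4)
        ≤ 2 * (3 + 2 * η₂) ^ 2 * ((σ * (1 + η₁)) ^ 2 * n * (4 * (T + L))) * s / (Cmin * n / 4) := by
          gcongr
      _ = _ := by
        rw [hρe]
        field_simp
        norm_num
  have h4 : |r - σ * √n| ≤ √n * errorBound σ Cmin η₁ η₂ K δ ρ := by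
    have := abs_sub_le r (l2 (e *ᵥ b)) (σ * √n)
    rw [errorBound]
    nlinarith
  have h5 : r / √n - σ = (r - σ * √n) / √n := by field_simp
  rw [h5, abs_div, abs_of_pos hsn, div_le_iff₀ hsn]
  linarith

/-- The probability bound for the failure of the good events. -/
noncomputable def failureBound (η₁ : ℝ) (K : ℕ) (δ ρ n : ℝ) : ℝ :=
  2 * Real.exp (n * (3 * K * ρ - 1 / 8)) + Real.exp (n * (2 * ρ - η₁ ^ 2 / 2))
    + 1 / (-Real.log ρ) + Real.exp (-(n / 2)) + 2 * Real.exp (-(n * δ ^ 2 / 2))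

-- The probabilistic half: a union bound over five bad events. The estimate need not be measurable,
-- since its event is only included in theirs.
set_option maxHeartbeats 1000000 in
theorem measure_adjustedResidual_deviation_le {Ω : Type*} [MeasurableSpace Ω] {P : Measure Ω}
    [IsProbabilityMeasure P] {σ Cmin Cmax η₁ η₂ : ℝ} {K : ℕ} (hσ : 0 < σ)
    (hCmin : 0 < Cmin) (hη₁ : 0 < η₁) (hη₂ : 0 < η₂)
    (hK : IsSparsityConstant Cmin Cmax η₂ K)
    (hn : 0 < n) (hT : 0 < T) (hs : 0 < s) (hsp : s ≤ p) (hnp : n ≤ p)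
    (hρ1 : rate n p T s < 1) (hρK : K * rate n p T s ≤ 1 / 2)
    {Sig : Matrix (Fin p) (Fin p) ℝ} (hSig : Sig.IsHermitian)
    (hspec : spectrum ℝ Sig ⊆ Set.Icc Cmin Cmax) (hdiag : ∀ j, Sig j j ≤ 1)
    {X : Ω → Matrix (Fin n) (Fin p) ℝ} {E : Ω → Matrix (Fin n) (Fin T) ℝ}
    (hmodel : GaussianModel P X E Sig σ)
    {Bs : Matrix (Fin p) (Fin T) ℝ} (hBs : (rowSupport Bs).card ≤ s) {lam : ℝ}
    (hlam : lam = (1 + η₂) * lambda0 η₁ σ n p T s Sig) {Bhat : Ω → Matrix (Fin p) (Fin T) ℝ}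
    (hBhat : ∀ ω, IsMultiTaskLasso (X ω) (X ω * Bs + E ω) lam (Bhat ω))
    {b : Fin T → ℝ} (hb : l2 b = 1) {δ : ℝ} (hδ : 0 < δ) (hδ1 : δ < 1) :
    P {ω | ¬(IsUnit (adjustment (X ω) lam (Bhat ω)).det ∧
      |l2 (adjustedResidual (X ω) (X ω * Bs + E ω) lam (Bhat ω) b) / √n - σ|
        ≤ errorBound σ Cmin η₁ η₂ K δ (rate n p T s))}
      ≤ ENNReal.ofReal (failureBound η₁ K δ (rate n p T s) n) := by
  set ρ := rate n p T s with hρ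
  set L := Real.log (p / s) with hLdef
  have hρe : ρ = s / n * (T + L) := rfl
  have hn' : (0 : ℝ) < n := by exact_mod_cast hn
  have hn1 : (1 : ℝ) ≤ n := by exact_mod_cast hn
  have hT1 : (1 : ℝ) ≤ T := by exact_mod_cast hT
  have hs1 : (1 : ℝ) ≤ s := by exact_mod_cast hs
  have hp' : (0 : ℝ) < p := by exact_mod_cast hs.trans_le hsp
  have hL0 : 0 ≤ L := Real.log_nonneg (by rw [le_div_iff₀ (by linarith)]; simpa using hsp)
  have hnρ : n * ρ = s * T + s * L := by rw [hρe]; field_simp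
  have hsρ : s ≤ n * ρ := by rw [hnρ]; nlinarith
  have hρ0 : 0 < ρ := by
    by_contra! h
    nlinarith
  -- As `T ≥ 1` and `n ≤ p`, `1/ρ ≤ n/s ≤ p/s`. This forces `L → ∞`, so the Markov bound `1/L`
  -- vanishes.
  have hLρ : -Real.log ρ ≤ L := by
    rw [← Real.log_inv, hLdef]
    refine Real.log_le_log (by positivity) ?_
    rw [inv_le_comm₀ hρ0 (by positivity), inv_div, div_le_iff₀ hp']
    have : (n : ℝ) ≤ p := by exact_mod_cast hnp
    nlinarith
  have hlogρ : 0 < -Real.log ρ := by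
    have := Real.log_neg hρ0 hρ1
    linarith
  have hL : 0 < L := hlogρ.trans_le hLρ
  have hKs : (K * s : ℝ) / n ≤ 1 / 2 := by
    rw [div_le_iff₀ hn']
    have := mul_le_mul_of_nonneg_left hsρ (Nat.cast_nonneg (α := ℝ) K)
    nlinarith
  have hkp : K * s ≤ p := by
    rw [div_le_iff₀ hn'] at hKs
    have h1 : (K * s : ℝ) ≤ n := by linarith
    have h2 : K * s ≤ n := by exact_mod_cast h1
    exact h2.trans hnp
  have hk0 : 0 < K * s := Nat.mul_pos (by linarith [hK.two_le]) hs
  have hpos : ∀ j, 0 < Sig j j := by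
    intro j
    have h1 := le_quadForm_of_spectrum hSig hspec (Pi.single j 1)
    have h2 : l2 (Pi.single j 1 : Fin p → ℝ) ^ 2 = 1 := by
      simpa [signedBasis] using l2_signedBasis_sq (j, true)
    rw [h2] at h1
    simp at h1
    linarith
  have : Nonempty (Fin p) := ⟨⟨0, hs.trans_le hsp⟩⟩
  have hMle : ∀ j, √(Sig j j) ≤ ⨆ j, √(Sig j j) :=
    fun j => le_ciSup (Set.finite_range fun j => √(Sig j j)).bddAbove j
  have hMpos : 0 < ⨆ j, √(Sig j j) :=
    (Real.sqrt_pos.2 (hpos (Classical.arbitrary _))).trans_le (hMle _)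
  have hM1 : (⨆ j, √(Sig j j)) ≤ 1 :=
    ciSup_le fun j => Real.sqrt_le_one.2 (hdiag j)
  have hCmax : 0 ≤ Cmax := by
    have h1 := hspec (hSig.eigenvalues_mem_spectrum_real (Classical.arbitrary _))
    linarith [h1.1, h1.2]
  have hPSD := posSemidef_of_spectrum hSig hspec hCmin.le
  set v := (σ * (1 + η₁) * ⨆ j, √(Sig j j)) ^ 2 * n with hv
  have hv0 : 0 < v := by positivity
  set τ := n * T * lambda0 η₁ σ n p T s Sig with hτ
  have hτe : τ = √(v * T) * (1 + √(2 * L / T)) := natCast_mul_lambda0 hη₁ hσ hn hT Sig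
  -- With `L = log (p/s)` this is an equality, which is why the excess is controlled at level `r =
  -- s`.
  have hexpL : p * Real.exp (-L) ≤ s := by
    rw [Real.exp_neg, hLdef, Real.exp_log (by positivity), inv_div]
    field_simp
    rfl
  have e1 := hmodel.measure_not_isSparseIsometry_le hSig hCmin hspec hk0 hkp
  have e2 := hmodel.measure_column_norm_le hPSD hpos hη₁
  have e3 := hmodel.measure_excess_le hv0 hL hT (by linarith : (0 : ℝ) < s) hexpL
  rw [← hτe] at e3
  have e4 := hmodel.measure_frobSq_noise_le hσ
  have e5 := hmodel.measure_noise_mulVec_deviation_le hσ hb hδ hδ1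
  refine (measure_mono (t := {ω | ¬IsSparseIsometry (X ω) (K * s) (Cmin * n / 4) (Cmax * n * 4)} ∪
    {ω | ∃ j, Sig j j * n * (1 + η₁) ^ 2 < ∑ i, X ω i j ^ 2} ∪
    {ω | (∀ j, σ ^ 2 * ∑ i, X ω i j ^ 2 ≤ v) ∧ s * τ ^ 2
        < GaussianModel.excess τ (X ω) (E ω)} ∪
    {ω | σ ^ 2 * (n * T) * 4 < frobSq (E ω)} ∪
    {ω | ¬|l2 (E ω *ᵥ b) - σ * √n| ≤ σ * √n * δ}) fun ω hω => ?_).trans ?_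
  · by_contra hgood
    simp only [Set.mem_union, Set.mem_ofPred_eq, not_or, not_not, not_exists, not_lt, not_and]
      at hgood
    obtain ⟨⟨⟨⟨g1, g2⟩, g3⟩, g4⟩, g5⟩ := hgood
    refine hω (hBhat ω |>.adjustedResidual_bound hσ hCmin hCmax hη₁ hη₂ hK hn hT hs hL hKs hMpos
      hM1 hBs hlam hb g1 (g3 fun j => ?_) g4 g5)
    calc σ ^ 2 * ∑ i, X ω i j ^ 2 ≤ σ ^ 2 * (Sig j j * n * (1 + η₁) ^ 2) := by
          gcongr
          exact g2 j
      _ ≤ σ ^ 2 * ((⨆ j, √(Sig j j)) ^ 2 * n * (1 + η₁) ^ 2) := by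
          gcongr
          exact diag_le_iSup_sq hpos j
      _ = v := by rw [hv]; ring
  · refine (measure_union_le _ _).trans ((add_le_add ((measure_union_le _ _).trans
      (add_le_add ((measure_union_le _ _).trans (add_le_add ((measure_union_le _ _).trans
        (add_le_add e1 e2)) e3)) e4)) e5).trans ?_)
    rw [← ENNReal.ofReal_add (by positivity) (by positivity),
      ← ENNReal.ofReal_add (by positivity) (by positivity),
      ← ENNReal.ofReal_add (by positivity) (by positivity),
      ← ENNReal.ofReal_add (by positivity) (by positivity)]
    refine ENNReal.ofReal_le_ofReal ?_
    rw [failureBound]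
    have hK1 : (1 : ℝ) ≤ K := by exact_mod_cast (by linarith [hK.two_le] : 1 ≤ K)
    -- The entropy of the multisets is at most `K s (3 T + L) ≤ 3 K n ρ`.
    have f1 : Real.exp ((K * s : ℕ) * (3 + Real.log (p / (K * s : ℕ))) - n / 8)
        ≤ Real.exp (n * (3 * K * ρ - 1 / 8)) := by
      refine Real.exp_le_exp.2 ?_
      have h1 : Real.log (p / (K * s : ℕ)) ≤ L := by
        refine Real.log_le_log (by positivity) ?_
        push_cast
        gcongr
        nlinarith
      have h2 : ((K * s : ℕ) : ℝ) * (3 + Real.log (p / (K * s : ℕ)))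
          ≤ ((K * s : ℕ) : ℝ) * (3 * T + L) := by
        gcongr
        linarith
      push_cast at h2 ⊢
      have h3 : (K : ℝ) * s * (3 * T + L) ≤ 3 * K * (n * ρ) := by
        rw [hnρ]
        have h4 : 0 ≤ (K : ℝ) * (s * L) := by positivity
        linarith
      linarith
    -- Here `log p = L + log s`, and each summand is at most `n ρ`.
    have f2 : p * Real.exp (-(n * η₁ ^ 2 / 2)) ≤ Real.exp (n * (2 * ρ - η₁ ^ 2 / 2)) := by
      have h1 : (p : ℝ) = Real.exp (L + Real.log s) := by
        rw [Real.exp_add, hLdef, Real.exp_log (by positivity), Real.exp_log (by positivity)]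
        field_simp
      rw [h1, ← Real.exp_add]
      refine Real.exp_le_exp.2 ?_
      have h2 : Real.log s ≤ s := by linarith [Real.log_le_sub_one_of_pos (by positivity : (0 : ℝ) < s)]
      have h3 : L ≤ n * ρ := by rw [hnρ]; nlinarith
      nlinarith
    have f3 : 1 / L ≤ 1 / (-Real.log ρ) := one_div_le_one_div_of_le hlogρ hLρ
    have f4 : Real.exp (-(n * T / 2)) ≤ Real.exp (-((n : ℝ) / 2)) := by
      refine Real.exp_le_exp.2 ?_
      nlinarith
    linarith

end Concentration

/-! ### Limits of the bounds -/

theorem tendsto_failureBound {η₁ : ℝ} (hη : 0 < η₁) (K : ℕ) {δ : ℝ} (hδ : 0 < δ) {ρ : ℕ → ℝ}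
    (hρ : Tendsto ρ atTop (𝓝 0)) (hρ0 : ∀ᶠ n in atTop, 0 < ρ n) :
    Tendsto (fun n : ℕ => failureBound η₁ K δ (ρ n) n) atTop (𝓝 0) := by
  have hexp : ∀ {f : ℕ → ℝ} {c : ℝ}, c < 0 → Tendsto f atTop (𝓝 c) →
      Tendsto (fun n : ℕ => Real.exp (n * f n)) atTop (𝓝 0) := fun hc hf =>
    Real.tendsto_exp_atBot.comp (tendsto_natCast_atTop_atTop.atTop_mul_neg hc hf)
  have h1 : Tendsto (fun n : ℕ => Real.exp (n * (3 * K * ρ n - 1 / 8))) atTop (𝓝 0) := by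
    refine hexp (c := 3 * K * 0 - 1 / 8) (by norm_num) ?_
    exact (hρ.const_mul _).sub_const _
  have h2 : Tendsto (fun n : ℕ => Real.exp (n * (2 * ρ n - η₁ ^ 2 / 2))) atTop (𝓝 0) := by
    refine hexp (c := 2 * 0 - η₁ ^ 2 / 2) (by have := sq_pos_of_pos hη; linarith) ?_
    exact (hρ.const_mul _).sub_const _
  have h3 : Tendsto (fun n : ℕ => 1 / (-Real.log (ρ n))) atTop (𝓝 0) := by
    have hw : Tendsto ρ atTop (𝓝[>] 0) := tendsto_nhdsWithin_iff.2 ⟨hρ, hρ0⟩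
    exact (tendsto_neg_atBot_atTop.comp (Real.tendsto_log_nhdsGT_zero.comp hw)).const_div_atTop 1
  have h4 : Tendsto (fun n : ℕ => Real.exp (-((n : ℝ) / 2))) atTop (𝓝 0) := by
    refine (hexp (f := fun _ => -(1 / 2)) (by norm_num) tendsto_const_nhds).congr fun n => ?_
    congr 1
    ring
  have h5 : Tendsto (fun n : ℕ => Real.exp (-((n : ℝ) * δ ^ 2 / 2))) atTop (𝓝 0) := by
    refine (hexp (f := fun _ => -(δ ^ 2 / 2)) (by have := sq_pos_of_pos hδ; linarith)
      tendsto_const_nhds).congr fun n => ?_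
    congr 1
    ring
  have := ((((h1.const_mul 2).add h2).add h3).add h4).add (h5.const_mul 2)
  simpa [failureBound] using this

theorem tendsto_errorBound (σ Cmin η₁ η₂ : ℝ) (K : ℕ) (δ : ℝ) {ρ : ℕ → ℝ}
    (hρ : Tendsto ρ atTop (𝓝 0)) :
    Tendsto (fun n => errorBound σ Cmin η₁ η₂ K δ (ρ n)) atTop (𝓝 (σ * δ)) := by
  have h1 := hρ.const_mul (4 * σ * K)
  have h2 := (hρ.const_mul (32 * ((3 + 2 * η₂) * (σ * (1 + η₁))) ^ 2 / Cmin)).sqrt.const_mul 2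
  have := (tendsto_const_nhds (x := σ * δ)).add h1 |>.add h2
  simpa [errorBound] using this

theorem ciUpper_sub_ciLower_div {n p T : ℕ} (X : Matrix (Fin n) (Fin p) ℝ)
    (Y : Matrix (Fin n) (Fin T) ℝ) (lam : ℝ) (B : Matrix (Fin p) (Fin T) ℝ)
    (Sig : Matrix (Fin p) (Fin p) ℝ) (a : Fin p → ℝ) (b : Fin T → ℝ) {z σ : ℝ} (hz : 0 < z)
    (hσ : 0 < σ) (hn : 0 < n) :
    (ciUpper X Y lam B Sig a b z - ciLower X Y lam B Sig a b z) / (2 * z * σ / √n)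
      = l2 (adjustedResidual X Y lam B b) / √n / σ := by
  have hsn : 0 < √(n : ℝ) := Real.sqrt_pos.2 (by exact_mod_cast hn)
  have hsnn : (n : ℝ) = √(n : ℝ) * √(n : ℝ) := (Real.mul_self_sqrt (Nat.cast_nonneg n)).symm
  have h1 : ciUpper X Y lam B Sig a b z - ciLower X Y lam B Sig a b z
      = 2 * z * l2 (adjustedResidual X Y lam B b) / (√n * √n) := by
    rw [ciUpper, ciLower, ← hsnn]
    ring
  rw [h1]
  field_simp

end MultiTask

theorem mainTheorem7
    {Ω : ℕ → Type*} [∀ n, MeasurableSpace (Ω n)]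
    (P : ∀ n, Measure (Ω n)) [∀ n, IsProbabilityMeasure (P n)]
    (σ Cmin Cmax η₁ η₂ : ℝ) (hσ : 0 < σ) (hCmin : 0 < Cmin)
    (hη₁ : 0 < η₁) (hη₂ : 0 < η₂)
    (p T s : ℕ → ℕ)
    (hT : ∀ n, 0 < T n) (hs : ∀ n, 0 < s n) (hsp : ∀ n, s n ≤ p n) (hnp : ∀ n, n ≤ p n)
    (hrate : Tendsto
      (fun n : ℕ => (s n : ℝ) / (n : ℝ) * ((T n : ℝ) + Real.log ((p n : ℝ) / (s n : ℝ))))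
      atTop (𝓝 0))
    (Sig : ∀ n, Matrix (Fin (p n)) (Fin (p n)) ℝ)
    (hSig : ∀ n, (Sig n).IsHermitian)
    (hspec : ∀ n, spectrum ℝ (Sig n) ⊆ Set.Icc Cmin Cmax)
    (hdiag : ∀ n j, Sig n j j ≤ 1)
    (Bstar : ∀ n, Matrix (Fin (p n)) (Fin (T n)) ℝ)
    (hsparse : ∀ n, (MultiTask.rowSupport (Bstar n)).card ≤ s n)
    (X : ∀ n, Ω n → Matrix (Fin n) (Fin (p n)) ℝ)
    (E Y : ∀ n, Ω n → Matrix (Fin n) (Fin (T n)) ℝ)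
    (hmodel : ∀ n, MultiTask.GaussianModel (P n) (X n) (E n) (Sig n) σ)
    (hY : ∀ n ω, Y n ω = X n ω * Bstar n + E n ω)
    (lam : ℕ → ℝ)
    (hlam : ∀ n, lam n = (1 + η₂) * MultiTask.lambda0 η₁ σ n (p n) (T n) (s n) (Sig n))
    (Bhat : ∀ n, Ω n → Matrix (Fin (p n)) (Fin (T n)) ℝ)
    (hBhat : ∀ n ω, MultiTask.IsMultiTaskLasso (X n ω) (Y n ω) (lam n) (Bhat n ω))
    (b : ∀ n, Fin (T n) → ℝ) (hb : ∀ n, MultiTask.l2 (b n) = 1) :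
    Tendsto (fun n => P n {ω | ¬ IsUnit (MultiTask.adjustment (X n ω) (lam n) (Bhat n ω)).det})
      atTop (𝓝 0) ∧
    MultiTask.TendstoInProb P
      (fun n ω => MultiTask.l2
        (MultiTask.adjustedResidual (X n ω) (Y n ω) (lam n) (Bhat n ω) (b n)) ^ 2 / (n : ℝ))
      (σ ^ 2) ∧
    ∀ α : ℝ, 0 < α → α < 1 →
      ∀ a : ∀ n, Fin (p n) → ℝ, (∀ n, a n ⬝ᵥ ((Sig n)⁻¹ *ᵥ a n) = 1) →
        MultiTask.TendstoInProb P
          (fun n ω =>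
            (MultiTask.ciUpper (X n ω) (Y n ω) (lam n) (Bhat n ω) (Sig n) (a n) (b n)
                (MultiTask.stdNormalQuantile (1 - α / 2))
              - MultiTask.ciLower (X n ω) (Y n ω) (lam n) (Bhat n ω) (Sig n) (a n) (b n)
                (MultiTask.stdNormalQuantile (1 - α / 2)))
              / (2 * MultiTask.stdNormalQuantile (1 - α / 2) * σ / √(n : ℝ)))
          1 := by
  obtain ⟨K, hK⟩ := MultiTask.exists_isSparsityConstant Cmin Cmax hη₂
  set ρ : ℕ → ℝ := fun n => MultiTask.rate n (p n) (T n) (s n) with hρ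
  have hρ0 : Tendsto ρ atTop (𝓝 0) := hrate
  have hρpos : ∀ᶠ n in atTop, 0 < ρ n := by
    filter_upwards [eventually_gt_atTop 0] with n hn
    have h1 : (0 : ℝ) < s n := by exact_mod_cast hs n
    have h2 : (0 : ℝ) < T n := by exact_mod_cast hT n
    have h3 : (0 : ℝ) < n := by exact_mod_cast hn
    have h4 : 0 ≤ Real.log ((p n : ℝ) / s n) :=
      Real.log_nonneg (by rw [le_div_iff₀ h1, one_mul]; exact_mod_cast hsp n)
    exact mul_pos (div_pos h1 h3) (by linarith)
  set w : ∀ n, Ω n → ℝ := fun n ω => MultiTask.l2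
    (MultiTask.adjustedResidual (X n ω) (Y n ω) (lam n) (Bhat n ω) (b n)) / √(n : ℝ) with hw
  have key : ∀ ε : ℝ, 0 < ε → Tendsto (fun n => P n {ω |
      ¬(IsUnit (MultiTask.adjustment (X n ω) (lam n) (Bhat n ω)).det ∧ |w n ω - σ| ≤ ε)})
      atTop (𝓝 0) := by
    intro ε hε
    -- This keeps `σ δ ≤ ε/2`, leaving room for the part of the error bound that vanishes with the
    -- rate.
    set δ := min (1 / 2) (ε / (2 * σ)) with hδ
    have hδ0 : 0 < δ := lt_min (by norm_num) (by positivity)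
    have hδ1 : δ < 1 := (min_le_left _ _).trans_lt (by norm_num)
    have hσδ : σ * δ < ε := by
      calc σ * δ ≤ σ * (ε / (2 * σ)) := by gcongr; exact min_le_right _ _
        _ = ε / 2 := by field_simp
        _ < ε := by linarith
    have hlim : Tendsto (fun n => ENNReal.ofReal (MultiTask.failureBound η₁ K δ (ρ n) n))
        atTop (𝓝 0) := by
      have := ENNReal.tendsto_ofReal (MultiTask.tendsto_failureBound hη₁ K hδ0 hρ0 hρpos)
      rwa [ENNReal.ofReal_zero] at this
    refine tendsto_of_tendsto_of_tendsto_of_le_of_le' tendsto_const_nhds hlim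
      (Eventually.of_forall fun _ => zero_le) ?_
    have hKρ : Tendsto (fun n => (K : ℝ) * ρ n) atTop (𝓝 0) := by
      simpa using hρ0.const_mul (K : ℝ)
    filter_upwards [eventually_gt_atTop 0, hρ0.eventually (gt_mem_nhds one_pos),
      hKρ.eventually (gt_mem_nhds (by norm_num : (0 : ℝ) < 1 / 2)),
      (MultiTask.tendsto_errorBound σ Cmin η₁ η₂ K δ hρ0).eventually (gt_mem_nhds hσδ)]
      with n hn h1 h2 h3
    refine (measure_mono fun ω hω => ?_).trans
      (MultiTask.measure_adjustedResidual_deviation_le hσ hCmin hη₁ hη₂ hK hn (hT n) (hs n)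
        (hsp n) (hnp n) h1 h2.le (hSig n) (hspec n) (hdiag n) (hmodel n) (hsparse n) (hlam n)
        (fun ω => hY n ω ▸ hBhat n ω) (hb n) hδ0 hδ1)
    refine fun hgood => hω ⟨hgood.1, ?_⟩
    simp only [hw, hY]
    exact hgood.2.trans h3.le
  -- A continuous-mapping step: both convergence claims are functions of `w` near `σ`. Only `n > 0`
  -- is asked for, because the length ratio is `w / σ` only then.
  have lift : ∀ (Z : ∀ n, Ω n → ℝ) (c : ℝ), (∀ ε : ℝ, 0 < ε → ∃ ε' : ℝ, 0 < ε' ∧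
      ∀ n, 0 < n → ∀ ω, |w n ω - σ| ≤ ε' → |Z n ω - c| ≤ ε) → MultiTask.TendstoInProb P Z c := by
    intro Z c hZ ε hε
    obtain ⟨ε', hε', h⟩ := hZ ε hε
    refine tendsto_of_tendsto_of_tendsto_of_le_of_le' tendsto_const_nhds (key ε' hε')
      (Eventually.of_forall fun _ => zero_le) ?_
    filter_upwards [eventually_gt_atTop 0] with n hn
    refine measure_mono fun ω hω hgood => ?_
    exact absurd (h n hn ω hgood.2) (not_le.2 hω)
  refine ⟨?_, lift _ _ fun ε hε => ?_, fun α hα hα1 a _ => lift _ _ fun ε hε => ?_⟩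
  · refine tendsto_of_tendsto_of_tendsto_of_le_of_le tendsto_const_nhds (key 1 one_pos)
      (fun _ => zero_le) fun n => measure_mono fun ω hω hgood => ?_
    exact hω hgood.1
  -- The `1` bounds `|w + σ|` by `2σ + 1`; the other term then controls `w² - σ² = (w + σ)(w - σ)`.
  · refine ⟨min 1 (ε / (2 * σ + 1)), lt_min one_pos (by positivity), fun n hn ω h => ?_⟩
    have h1 : MultiTask.l2
        (MultiTask.adjustedResidual (X n ω) (Y n ω) (lam n) (Bhat n ω) (b n)) ^ 2 / (n : ℝ)
        = w n ω ^ 2 := by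
      simp only [hw]
      rw [div_pow, Real.sq_sqrt (Nat.cast_nonneg n)]
    have h2 : |w n ω + σ| ≤ 2 * σ + 1 := by
      have h3 := abs_le.1 (h.trans (min_le_left _ _))
      rw [abs_le]
      constructor <;> linarith
    rw [h1, sq_sub_sq, abs_mul]
    calc |w n ω + σ| * |w n ω - σ| ≤ (2 * σ + 1) * (ε / (2 * σ + 1)) := by
          gcongr
          exact h.trans (min_le_right _ _)
      _ = ε := by field_simp
  · refine ⟨σ * ε, by positivity, fun n hn ω h => ?_⟩
    have hz : 0 < MultiTask.stdNormalQuantile (1 - α / 2) :=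
      MultiTask.stdNormalQuantile_pos (by linarith) (by linarith)
    rw [MultiTask.ciUpper_sub_ciLower_div _ _ _ _ _ _ _ hz hσ hn]
    have h1 : w n ω / σ - 1 = (w n ω - σ) / σ := by field_simp
    change |w n ω / σ - 1| ≤ ε
    rw [h1, abs_div, abs_of_pos hσ, div_le_iff₀ hσ]
    linarith
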